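/- Call a group *Coxeter* if it admits a presentation $\langle S \mid (ss')^{m(s,s')} = e \ (s,s' \in S,\ m(s,s') < \infty)\rangle$ with $S$ finite, where $m : S \times S \to \{1,2,\dots,\infty\}$ is symmetric and $m(s,s') = 1$ if and only if $s = s'$; the associated Coxeter diagram is the graph on $S$ in which distinct $s, s'$ are joined by an edge when $m(s,s') \neq 2$ (in particular when $m(s,s') = \infty$). Call a group *finitely torsion-generated* if it is generated by finitely many elements of finite order, and call two groups *elementarily equivalent* if they satisfy the same first-order sentences in the language of groups. Consider, for a Coxeter group $W$, the assertion $(\ast)_W$: every finitely torsion-generated group $G$ that is elementarily equivalent to $W$ is a Coxeter group. Theorem. The following are equivalent: 1. $(\ast)_W$ holds for every Coxeter group $W$; 2. $(\ast)_W$ holds for every irreducible Coxeter group $W$, where *irreducible* means that $W$ has a Coxeter presentation as above whose Coxeter diagram is non-empty and connected; 3. $(\ast)_W$ holds for every Coxeter group $W$ that is irreducible in the sense of being non-trivial and not isomorphic to a direct product of two non-trivial groups. -/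

import Mathlib

universe u v

/-- The function symbols of the first-order language of groups. -/
inductive GroupFunc : ℕ → Type
  | one : GroupFunc 0
  | inv : GroupFunc 1
  | mul : GroupFunc 2

/-- The first-order language of groups: a constant `1`, a unary function symbol `⁻¹`, a binary
function symbol `*`, and no relation symbols besides equality. -/
def groupLanguage : FirstOrder.Language.{0, 0} :=
  ⟨GroupFunc, fun _ => Empty⟩

/-- Every group is a structure for the language of groups in the obvious way. -/
instance groupStructure (G : Type*) [Group G] : groupLanguage.Structure G where
  funMap := fun {_} f =>
    match f with
    | GroupFunc.one => fun _ => 1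
    | GroupFunc.inv => fun x => (x 0)⁻¹
    | GroupFunc.mul => fun x => x 0 * x 1
  RelMap := fun {_} r => Empty.elim r

/-- Two groups are elementarily equivalent if they satisfy the same first-order sentences in the
language of groups. -/
def ElementarilyEquivalentGroups (G : Type*) (H : Type*) [Group G] [Group H] : Prop :=
  groupLanguage.ElementarilyEquivalent G H

/-- A group is finitely torsion-generated if it is generated by finitely many torsion elements. -/
def FinitelyTorsionGenerated (G : Type*) [Group G] : Prop :=
  ∃ T : Finset G, (∀ g ∈ T, IsOfFinOrder g) ∧ Subgroup.closure (T : Set G) = ⊤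

/-- The (finitely generated) Coxeter groups: the groups `W` that admit a Coxeter system `(W, S)`
with `S` finite. -/
def IsFinRankCoxeterGroup (W : Type*) [Group W] : Prop :=
  ∃ (n : ℕ) (M : CoxeterMatrix (Fin n)), Nonempty (CoxeterSystem M W)

/-- The Coxeter diagram of a Coxeter matrix, labels forgotten: distinct `i` and `j` are joined by
an edge when `m(i, j) ≠ 2`. In Mathlib the entry `0` stands for `m(i, j) = ∞`, so that those pairs
are joined too. -/
def coxeterDiagram {B : Type*} (M : CoxeterMatrix B) : SimpleGraph B where
  Adj i j := i ≠ j ∧ M i j ≠ 2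
  symm := ⟨fun i j h => ⟨h.1.symm, by rw [M.symmetric j i]; exact h.2⟩⟩
  loopless := ⟨fun _ h => h.1 rfl⟩

/-- `W` is a Coxeter group with connected Coxeter diagram, that is, `W` admits a Coxeter
system `(W, S)` with `S` finite whose Coxeter diagram is (non-empty and) connected. -/
def IsConnectedCoxeterGroup (W : Type*) [Group W] : Prop :=
  ∃ (n : ℕ) (M : CoxeterMatrix (Fin n)),
    Nonempty (CoxeterSystem M W) ∧ (coxeterDiagram M).Connected

/-- `W` is non-trivial and cannot be written as a non-trivial direct product. -/
def DirectlyIndecomposable (W : Type u) [Group W] : Prop :=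
  Nontrivial W ∧
    ∀ (A B : Type u) [Group A] [Group B],
      Nonempty (W ≃* A × B) → Subsingleton A ∨ Subsingleton B

/-- The assertion of the conjecture for one group `W`: every finitely torsion-generated
group that is elementarily equivalent to `W` is a Coxeter group. -/
def TorsionGeneratedModelsAreCoxeter (W : Type u) [Group W] : Prop :=
  ∀ (G : Type v) [Group G], FinitelyTorsionGenerated G →
    ElementarilyEquivalentGroups G W → IsFinRankCoxeterGroup G

/-! A Coxeter group is the product of the groups of the components of its diagram. Collect the
finite components into a finite group `F`; the others are infinite with connected diagram, and the
assertion is only needed for those. It remains to show that a finitely torsion-generated `G`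
elementarily equivalent to `W` splits into direct factors matching those of `W`. Such factors are
quotients of `G`, hence finitely torsion-generated, and a product of Coxeter groups is Coxeter.

The structure theory rests on the geometric representation, which is faithful and whose roots are
each positive or negative. The centre of a Coxeter group has exponent two. An infinite one with
connected diagram has trivial centre, no nontrivial finite normal subgroup
(`eq_bot_of_finite_normal`) and no nontrivial direct decomposition
(`eq_bot_or_eq_bot_of_isInternalProd`). Hence both notions of irreducibility cover the infinite
components.

The transfer to `G` rests on definability with parameters. In the centreless part, a direct factor
is the centralizer of finitely many elements; `F` is given by listing its elements. Truth in a
quotient by a definable normal subgroup is expressible (`realize_quotient`). Up to defining the same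
subgroups there are finitely many choices of parameters, so a single choice in `G` satisfies all the
required formulas at once (`exists_realization`).

The copy `K` of `F` in `G` satisfies `G = K C(K)`, but a complement is not directly definable.
Modulo squares a group is an `𝔽₂`-vector space, where complements exist, so it suffices that
products of squares from `C(K)` meet `K` trivially. This is one formula for each number of squares,
true in `W` because the centre of `F` has exponent two. -/

namespace CoxeterMatrix

/-! ### The geometric representation and its dihedral subgroups -/

variable {B : Type*} (M : CoxeterMatrix B)

/-- Twice the entries of the Gram matrix of the geometric representation. An entry `0` of `M`,
standing for `∞`, gives `-2`. -/
noncomputable def cartan (i j : B) : ℝ := -(2 * Real.cos (Real.pi / M i j))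

theorem cartan_symm (i j : B) : M.cartan i j = M.cartan j i := by
  simp [cartan, M.symmetric i j]

theorem cartan_self (i : B) : M.cartan i i = 2 := by simp [cartan]

theorem cartan_ne_zero {i j : B} (h : M i j ≠ 2) : M.cartan i j ≠ 0 := by
  rw [cartan, neg_ne_zero]
  refine mul_ne_zero two_ne_zero ?_
  rcases Nat.lt_or_ge (M i j) 2 with h' | h'
  · interval_cases M i j <;> simp
  · have h3 : (3 : ℝ) ≤ M i j := by exact_mod_cast (show 3 ≤ M i j by omega)
    refine (Real.cos_pos_of_mem_Ioo ⟨?_, ?_⟩).ne'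
    · have := Real.pi_pos
      have : 0 ≤ Real.pi / M i j := by positivity
      linarith
    · exact div_lt_div_of_pos_left Real.pi_pos two_pos (by linarith)

/-- The coroot of the simple root `i` as a linear functional. -/
noncomputable def coroot (i : B) : Module.Dual ℝ (B →₀ ℝ) :=
  Finsupp.linearCombination ℝ (fun j => M.cartan i j)

/-- The simple root attached to `i`. -/
noncomputable def simpleRoot (_ : CoxeterMatrix B) (i : B) : B →₀ ℝ := Finsupp.single i 1

@[simp] theorem coroot_simpleRoot (i j : B) : M.coroot i (M.simpleRoot j) = M.cartan i j := by
  simp [coroot, simpleRoot]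

theorem simpleRoot_ne_zero (i : B) : M.simpleRoot i ≠ 0 := by simp [simpleRoot]

theorem simpleRoot_nonneg (i : B) : 0 ≤ M.simpleRoot i := by
  simp [simpleRoot]

theorem coroot_self (i : B) : M.coroot i (M.simpleRoot i) = 2 := by simp [cartan_self]

/-- The reflection in the simple root `i`. -/
noncomputable def simpleReflection (i : B) : (B →₀ ℝ) ≃ₗ[ℝ] (B →₀ ℝ) :=
  Module.reflection (M.coroot_self i)

theorem simpleReflection_apply (i : B) (v : B →₀ ℝ) :
    M.simpleReflection i v = v - M.coroot i v • M.simpleRoot i :=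
  Module.reflection_apply _ _

theorem simpleReflection_simpleRoot (i : B) :
    M.simpleReflection i (M.simpleRoot i) = -M.simpleRoot i :=
  Module.reflection_apply_self _

-- Powers of a product of two reflections are given by Chebyshev polynomials at `2 cos θ`, with `S
-- n` equal to `sin ((n + 1) θ) / sin θ`. For `θ = 2π / m`, each coefficient of the `m`-th power has
-- a vanishing factor: `S (k - 1)` if `m = 2k`, and `S k + S (k - 1)` if `m = 2k + 1`.
open Polynomial.Chebyshev in
theorem isLiftable_simpleReflection : M.IsLiftable M.simpleReflection := by
  intro i j
  rcases eq_or_ne i j with rfl | hij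
  · rw [M.diagonal, pow_one]
    ext1 v
    exact Module.involutive_reflection (M.coroot_self i) v
  ext1 z
  rcases Nat.eq_zero_or_pos (M i j) with h0 | hpos
  · rw [h0, pow_zero]
  have h1 : M i j ≠ 1 := M.off_diagonal i j hij
  have hform := Module.reflection_mul_reflection_pow_apply (M.coroot_self i) (M.coroot_self j)
    (M i j) z
  rw [coroot_simpleRoot, coroot_simpleRoot, M.cartan_symm j i] at hform
  change ((M.simpleReflection i * M.simpleReflection j) ^ M i j) z = _ at hform
  rw [hform]
  -- For `m = 2` the angle is `π` and `sin θ = 0`, so the quotient formula is not available.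
  rcases eq_or_ne (M i j) 2 with h2 | h2
  · have hc : M.cartan i j = 0 := by simp [cartan, h2]
    rw [h2, hc]
    norm_num
    module
  have h3 : 3 ≤ M i j := by omega
  set θ : ℝ := 2 * (Real.pi / M i j) with hθ
  have ht : M.cartan i j * M.cartan i j - 2 = 2 * Real.cos θ := by
    rw [hθ, Real.cos_two_mul, cartan]; ring
  have hM : (M i j : ℝ) ≠ 0 := by exact_mod_cast hpos.ne'
  have h3' : (3 : ℝ) ≤ M i j := by exact_mod_cast h3
  have hMθ : (M i j : ℝ) * θ = 2 * Real.pi := by rw [hθ]; field_simp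
  have hsin : Real.sin θ ≠ 0 := by
    refine (Real.sin_pos_of_pos_of_lt_pi (by have := Real.pi_pos; positivity) ?_).ne'
    have := Real.pi_pos
    nlinarith
  have key : ∀ n : ℤ, (S ℝ n).eval (2 * Real.cos θ) = Real.sin ((n + 1) * θ) / Real.sin θ := by
    intro n
    rw [eq_div_iff hsin, S_two_mul_real_cos]
  rw [ht]
  rcases Nat.even_or_odd' (M i j) with ⟨k, hk | hk⟩
  · have e1 : ((M i j : ℤ) - 1) / 2 = k - 1 := by omega
    have e2 : ((M i j : ℤ) - 2) / 2 = k - 1 := by omega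
    have hz : (S ℝ ((k : ℤ) - 1)).eval (2 * Real.cos θ) = 0 := by
      rw [key]
      have : (((k : ℤ) - 1 : ℤ) + 1 : ℝ) * θ = Real.pi := by
        have hk' : (M i j : ℝ) = 2 * k := by exact_mod_cast hk
        rw [hk'] at hMθ
        push_cast
        linarith
      rw [this, Real.sin_pi, zero_div]
    rw [e1, e2, hz]
    simp
  · have e1 : ((M i j : ℤ) - 1) / 2 = k := by omega
    have e2 : ((M i j : ℤ) - 2) / 2 = k - 1 := by omega
    have e3 : ((M i j : ℤ) - 3) / 2 = k - 1 := by omega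
    have e4 : (M i j : ℤ) / 2 = k := by omega
    have hz : (S ℝ (k : ℤ)).eval (2 * Real.cos θ) + (S ℝ ((k : ℤ) - 1)).eval (2 * Real.cos θ) = 0 := by
      rw [key, key, ← add_div]
      have hk' : (M i j : ℝ) = 2 * k + 1 := by exact_mod_cast hk
      rw [hk'] at hMθ
      have : ((k : ℤ) + 1 : ℝ) * θ = 2 * Real.pi - (((k : ℤ) - 1 : ℤ) + 1 : ℝ) * θ := by
        push_cast
        linarith
      rw [this, Real.sin_two_pi_sub]
      simp
    rw [e1, e2, e3, e4, hz]
    simp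

/-- The symmetric bilinear form of the geometric representation. -/
noncomputable def form : (B →₀ ℝ) →ₗ[ℝ] Module.Dual ℝ (B →₀ ℝ) :=
  Finsupp.linearCombination ℝ M.coroot

@[simp] theorem form_simpleRoot_left (i : B) (v : B →₀ ℝ) :
    M.form (M.simpleRoot i) v = M.coroot i v := by
  simp [form, simpleRoot]

@[simp] theorem form_simpleRoot_right (i : B) (v : B →₀ ℝ) :
    M.form v (M.simpleRoot i) = M.coroot i v := by
  induction v using Finsupp.induction_linear with
  | zero => simp
  | add f g hf hg => simp [hf, hg]
  | single j c => simp [form, coroot, simpleRoot, M.cartan_symm i j]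

theorem form_simpleReflection (i : B) (v w : B →₀ ℝ) :
    M.form (M.simpleReflection i v) (M.simpleReflection i w) = M.form v w := by
  simp only [simpleReflection_apply, map_sub, map_smul, LinearMap.sub_apply, LinearMap.smul_apply,
    form_simpleRoot_left, form_simpleRoot_right, coroot_self, smul_eq_mul]
  ring

/-- The coefficients `sin (n π / m) / sin (π / m)` of the roots of a dihedral group. -/
noncomputable def dihedralCoeff (i j : B) : ℕ → ℝ
  | 0 => 0
  | 1 => 1
  | n + 2 => -M.cartan i j * dihedralCoeff i j (n + 1) - dihedralCoeff i j n

theorem dihedralCoeff_mul_sin (i j : B) (n : ℕ) :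
    M.dihedralCoeff i j n * Real.sin (Real.pi / M i j) = Real.sin (n * (Real.pi / M i j)) := by
  induction n using Nat.twoStepInduction with
  | zero => simp [dihedralCoeff]
  | one => simp [dihedralCoeff]
  | more n h1 h2 =>
    rw [dihedralCoeff, sub_mul, mul_assoc, h1, h2, cartan]
    set x := Real.pi / M i j
    push_cast at *
    have e1 : ((n : ℝ) + 2) * x = (n + 1) * x + x := by ring
    have e2 : (n : ℝ) * x = (n + 1) * x - x := by ring
    rw [e1, e2, Real.sin_add, Real.sin_sub]
    ring

/-- Here `π / 0 = 0` turns the sine identity into `0 = 0`, so the recursion is solved directly, with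
`cartan` equal to `-2`. -/
theorem dihedralCoeff_of_eq_zero {i j : B} (h : M i j = 0) (n : ℕ) :
    M.dihedralCoeff i j n = n := by
  induction n using Nat.twoStepInduction with
  | zero => simp [dihedralCoeff]
  | one => simp [dihedralCoeff]
  | more n h1 h2 =>
    rw [dihedralCoeff, h1, h2, cartan, h]
    push_cast
    simp
    ring

theorem dihedralCoeff_nonneg {i j : B} (hij : i ≠ j) {n : ℕ} (h : M i j = 0 ∨ n ≤ M i j) :
    0 ≤ M.dihedralCoeff i j n := by
  rcases Nat.eq_zero_or_pos (M i j) with h0 | hpos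
  · rw [M.dihedralCoeff_of_eq_zero h0]; positivity
  have hn : n ≤ M i j := by omega
  have h1 : M i j ≠ 1 := M.off_diagonal i j hij
  have h2 : (2 : ℝ) ≤ M i j := by exact_mod_cast (show 2 ≤ M i j by omega)
  have hM : (0 : ℝ) < M i j := by linarith
  have hπ := Real.pi_pos
  have hs : 0 < Real.sin (Real.pi / M i j) := by
    refine Real.sin_pos_of_pos_of_lt_pi (by positivity) ?_
    rw [div_lt_iff₀ hM]
    nlinarith
  refine nonneg_of_mul_nonneg_left ?_ hs
  rw [dihedralCoeff_mul_sin]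
  refine Real.sin_nonneg_of_nonneg_of_le_pi (by positivity) ?_
  have hn' : (n : ℝ) ≤ M i j := by exact_mod_cast hn
  rw [← mul_div_assoc, div_le_iff₀ hM]
  nlinarith

end CoxeterMatrix

/-! ### Signs of roots and faithfulness -/

namespace CoxeterSystem

variable {B : Type*} {M : CoxeterMatrix B} {W : Type*} [Group W] (cs : CoxeterSystem M W)

/-- The geometric representation of a Coxeter system. -/
noncomputable def geomRep : W →* ((B →₀ ℝ) ≃ₗ[ℝ] (B →₀ ℝ)) :=
  cs.lift ⟨M.simpleReflection, M.isLiftable_simpleReflection⟩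

@[simp] theorem geomRep_simple (i : B) : cs.geomRep (cs.simple i) = M.simpleReflection i :=
  cs.lift_apply_simple _ i

theorem geomRep_mul_apply (x y : W) (v : B →₀ ℝ) :
    cs.geomRep (x * y) v = cs.geomRep x (cs.geomRep y v) := by
  rw [map_mul, LinearEquiv.mul_apply]

theorem form_geomRep (x : W) (v w : B →₀ ℝ) :
    M.form (cs.geomRep x v) (cs.geomRep x w) = M.form v w := by
  induction x using cs.simple_induction_left with
  | one => simp
  | mul_simple_left x i ih =>
    rw [geomRep_mul_apply, geomRep_mul_apply, geomRep_simple, M.form_simpleReflection, ih]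

theorem geomRep_alternatingWord (i j : B) (n : ℕ) :
    cs.geomRep (cs.wordProd (alternatingWord i j n)) (M.simpleRoot i) =
      if Even n then
        M.dihedralCoeff i j (n + 1) • M.simpleRoot i + M.dihedralCoeff i j n • M.simpleRoot j
      else
        M.dihedralCoeff i j n • M.simpleRoot i + M.dihedralCoeff i j (n + 1) • M.simpleRoot j := by
  induction n with
  | zero => simp [alternatingWord, CoxeterMatrix.dihedralCoeff]
  | succ n ih =>
    rw [alternatingWord_succ', wordProd_cons, geomRep_mul_apply, ih]
    by_cases h : Even n
    · have h' : ¬ Even (n + 1) := by simp [h, parity_simps]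
      simp only [h, h', if_true, if_false, geomRep_simple, map_add, map_smul,
        CoxeterMatrix.simpleReflection_apply, CoxeterMatrix.coroot_simpleRoot,
        CoxeterMatrix.cartan_self, CoxeterMatrix.dihedralCoeff, M.cartan_symm j i]
      module
    · have h' : Even (n + 1) := by simp [h, parity_simps]
      simp only [h, h', if_true, if_false, geomRep_simple, map_add, map_smul,
        CoxeterMatrix.simpleReflection_apply, CoxeterMatrix.coroot_simpleRoot,
        CoxeterMatrix.cartan_self, CoxeterMatrix.dihedralCoeff]
      module

/-- Strip from `w` the longest alternating suffix that shortens it by its full length. Maximality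
excludes one descent of `x`; the other would cancel against the first letter of the suffix. A suffix
of length `m` could be rewritten by the braid relation to end in `i`, making `i` a descent of `w`.
-/
theorem exists_maximal_alternating_suffix {w : W} {i j : B} (hi : ¬ cs.IsRightDescent w i)
    (hj : cs.IsRightDescent w j) :
    ∃ (n : ℕ) (x : W), w = x * cs.wordProd (alternatingWord i j n) ∧
      cs.length x < cs.length w ∧ (M i j = 0 ∨ n + 1 ≤ M i j) ∧
      ¬ cs.IsRightDescent x i ∧ ¬ cs.IsRightDescent x j := by
  classical
  let P : ℕ → Prop := fun n => ∃ x : W, w = x * cs.wordProd (alternatingWord i j n) ∧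
    cs.length w = cs.length x + n
  have hP1 : P 1 := ⟨w * cs.simple j, by simp [alternatingWord],
    ((cs.isRightDescent_iff).1 hj).symm⟩
  have hbound : ∀ n, P n → n ≤ cs.length w := by
    rintro n ⟨x, -, hx⟩
    omega
  set n := Nat.findGreatest P (cs.length w) with hn
  have hPn : P n := Nat.findGreatest_spec (hbound 1 hP1) hP1
  have hn1 : 1 ≤ n := Nat.le_findGreatest (hbound 1 hP1) hP1
  have hmax : ¬ P (n + 1) := fun h =>
    absurd (Nat.le_findGreatest (hbound _ h) h) (by omega)
  obtain ⟨x, hw, hlen⟩ := hPn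
  have hnext : ¬ cs.IsRightDescent x (if Even n then j else i) := by
    intro h
    rw [cs.isRightDescent_iff] at h
    refine hmax ⟨x * cs.simple (if Even n then j else i), ?_, by omega⟩
    rw [alternatingWord_succ', wordProd_cons, mul_assoc, simple_mul_simple_cancel_left]
    exact hw
  have hprev : ¬ cs.IsRightDescent x (if Even n then i else j) := by
    intro h
    rw [cs.isRightDescent_iff] at h
    obtain ⟨k, hk⟩ : ∃ k, n = k + 1 := ⟨n - 1, by omega⟩
    have hpar : (if Even n then i else j) = if Even k then j else i := by
      rw [hk]
      by_cases hk' : Even k <;> simp [hk', parity_simps]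
    rw [hk, alternatingWord_succ', wordProd_cons, ← mul_assoc, ← hpar] at hw
    have h1 := cs.length_mul_le (x * cs.simple (if Even n then i else j))
      (cs.wordProd (alternatingWord i j k))
    have h2 := cs.length_wordProd_le (alternatingWord i j k)
    rw [length_alternatingWord] at h2
    rw [← hw] at h1
    omega
  refine ⟨n, x, hw, by omega, ?_, ?_, ?_⟩
  · by_contra! hcon
    obtain ⟨h0, hlt⟩ := hcon
    obtain ⟨k, hk⟩ : ∃ k, M i j = k + 1 := ⟨M i j - 1, by omega⟩
    have hred : cs.IsReduced (alternatingWord i j n) := by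
      have h1 := cs.length_mul_le x (cs.wordProd (alternatingWord i j n))
      have h2 := cs.length_wordProd_le (alternatingWord i j n)
      rw [← hw] at h1
      rw [length_alternatingWord] at h2
      unfold IsReduced
      rw [length_alternatingWord]
      omega
    have hnM : n = M i j := by
      by_contra hne
      exact cs.not_isReduced_alternatingWord i j h0 (by omega) hred
    have hb := cs.wordProd_braidWord_eq i j
    rw [braidWord, braidWord, M.symmetric j i, ← hnM, show n = k + 1 by omega,
      alternatingWord_succ j i, wordProd_concat] at hb
    rw [show n = k + 1 by omega, hb, ← mul_assoc] at hw
    refine hi ?_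
    unfold IsRightDescent
    rw [hw, simple_mul_simple_cancel_right, ← hw]
    have h1 := cs.length_mul_le x (cs.wordProd (alternatingWord i j k))
    have h2 := cs.length_wordProd_le (alternatingWord i j k)
    rw [length_alternatingWord] at h2
    omega
  · by_cases h : Even n
    · simpa [h] using hprev
    · simpa [h] using hnext
  · by_cases h : Even n
    · simpa [h] using hnext
    · simpa [h] using hprev

/-- If `i` is not a right descent of `w`, then `w` maps the simple root `i` to a nonnegative
combination of simple roots. -/
theorem geomRep_simpleRoot_nonneg {w : W} {i : B} (h : ¬ cs.IsRightDescent w i) :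
    0 ≤ cs.geomRep w (M.simpleRoot i) := by
  induction hl : cs.length w using Nat.strong_induction_on generalizing w i with
  | _ l ih =>
    by_cases hw : w = 1
    · simpa [hw] using M.simpleRoot_nonneg i
    obtain ⟨j, hj⟩ := cs.exists_rightDescent_of_ne_one hw
    have hij : i ≠ j := by rintro rfl; exact h hj
    -- The dihedral suffix sends the simple root `i` to a nonnegative combination of the simple
    -- roots `i` and `j`; by induction `x` keeps both nonnegative.
    obtain ⟨n, x, hx, hlt, hn, hxi, hxj⟩ := cs.exists_maximal_alternating_suffix h hj
    have pi := ih _ (hl ▸ hlt) hxi rfl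
    have pj := ih _ (hl ▸ hlt) hxj rfl
    have c1 : 0 ≤ M.dihedralCoeff i j n := M.dihedralCoeff_nonneg hij (by omega)
    have c2 : 0 ≤ M.dihedralCoeff i j (n + 1) := M.dihedralCoeff_nonneg hij hn
    rw [hx, geomRep_mul_apply, geomRep_alternatingWord]
    split_ifs <;> rw [map_add, map_smul, map_smul] <;>
      exact add_nonneg (smul_nonneg ‹_› pi) (smul_nonneg ‹_› pj)

theorem geomRep_simpleRoot_nonpos {w : W} {i : B} (h : cs.IsRightDescent w i) :
    cs.geomRep w (M.simpleRoot i) ≤ 0 := by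
  rw [cs.isRightDescent_iff_not_isRightDescent_mul] at h
  have := cs.geomRep_simpleRoot_nonneg h
  rw [geomRep_mul_apply, geomRep_simple, M.simpleReflection_simpleRoot, map_neg] at this
  exact neg_nonneg.1 this

theorem eq_one_of_geomRep_simpleRoot_eq {w : W}
    (h : ∀ i, cs.geomRep w (M.simpleRoot i) = M.simpleRoot i) : w = 1 := by
  by_contra hw
  obtain ⟨i, hi⟩ := cs.exists_rightDescent_of_ne_one hw
  have h1 := cs.geomRep_simpleRoot_nonpos hi
  rw [h] at h1
  exact M.simpleRoot_ne_zero i (le_antisymm h1 (M.simpleRoot_nonneg i))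

theorem geomRep_injective : Function.Injective cs.geomRep := by
  refine (injective_iff_map_eq_one _).2 fun w hw => cs.eq_one_of_geomRep_simpleRoot_eq fun i => ?_
  simp [hw]

end CoxeterSystem

/-! ### Roots, the centre and finite normal subgroups -/

namespace CoxeterSystem

variable {B : Type*} {M : CoxeterMatrix B} {W : Type*} [Group W] (cs : CoxeterSystem M W)

/-- The set of roots of a Coxeter system. -/
def rootSet : Set (B →₀ ℝ) := {β | ∃ w i, β = cs.geomRep w (M.simpleRoot i)}

theorem geomRep_mem_rootSet (w : W) {β : B →₀ ℝ} (h : β ∈ cs.rootSet) :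
    cs.geomRep w β ∈ cs.rootSet := by
  obtain ⟨x, i, rfl⟩ := h
  exact ⟨w * x, i, by rw [geomRep_mul_apply]⟩

theorem neg_mem_rootSet {β : B →₀ ℝ} (h : β ∈ cs.rootSet) : -β ∈ cs.rootSet := by
  obtain ⟨x, i, rfl⟩ := h
  exact ⟨x * cs.simple i, i, by
    rw [geomRep_mul_apply, geomRep_simple, M.simpleReflection_simpleRoot, map_neg]⟩

theorem form_self_of_mem_rootSet {β : B →₀ ℝ} (h : β ∈ cs.rootSet) : M.form β β = 2 := by
  obtain ⟨x, i, rfl⟩ := h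
  rw [form_geomRep, M.form_simpleRoot_left, M.coroot_self]

theorem nonneg_or_nonpos_of_mem_rootSet {β : B →₀ ℝ} (h : β ∈ cs.rootSet) : 0 ≤ β ∨ β ≤ 0 := by
  obtain ⟨x, i, rfl⟩ := h
  by_cases hx : cs.IsRightDescent x i
  · exact Or.inr (cs.geomRep_simpleRoot_nonpos hx)
  · exact Or.inl (cs.geomRep_simpleRoot_nonneg hx)

theorem ne_zero_of_mem_rootSet {β : B →₀ ℝ} (h : β ∈ cs.rootSet) : β ≠ 0 := by
  rintro rfl
  simpa using cs.form_self_of_mem_rootSet h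

theorem eq_or_eq_neg_of_mem_rootSet {c : ℝ} {i : B} (h : c • M.simpleRoot i ∈ cs.rootSet) :
    c = 1 ∨ c = -1 := by
  have := cs.form_self_of_mem_rootSet h
  simp only [map_smul, LinearMap.smul_apply, M.form_simpleRoot_left, M.coroot_self,
    smul_eq_mul] at this
  exact mul_self_eq_one_iff.1 (by linarith)

/-- A simple reflection makes only its own simple root negative. -/
theorem eq_simpleRoot_of_simpleReflection_nonpos {β : B →₀ ℝ} (h : β ∈ cs.rootSet) (h0 : 0 ≤ β)
    {i : B} (hi : M.simpleReflection i β ≤ 0) : β = M.simpleRoot i := by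
  classical
  have hβ : β = β i • M.simpleRoot i := by
    ext j
    by_cases hj : j = i
    · subst hj; simp [CoxeterMatrix.simpleRoot]
    · have h1 := hi j
      have h2 := h0 j
      simp [CoxeterMatrix.simpleReflection_apply, CoxeterMatrix.simpleRoot,
        Ne.symm hj] at h1 h2 ⊢
      exact le_antisymm h1 h2
  rw [hβ] at h
  rcases cs.eq_or_eq_neg_of_mem_rootSet h with hc | hc
  · rw [hβ, hc, one_smul]
  · have := h0 i
    simp only [Finsupp.coe_zero, Pi.zero_apply] at this
    linarith

/-- Left multiplication by a simple reflection adds at most one inversion, the root that `w` sends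
to the corresponding simple root. -/
theorem finite_inversions (w : W) :
    {β | β ∈ cs.rootSet ∧ 0 ≤ β ∧ cs.geomRep w β ≤ 0}.Finite := by
  induction w using cs.simple_induction_left with
  | one =>
    refine Set.Finite.subset Set.finite_empty ?_
    rintro β ⟨h, h0, h1⟩
    exact cs.ne_zero_of_mem_rootSet h (le_antisymm (by simpa using h1) h0)
  | mul_simple_left w i ih =>
    refine (ih.union (Set.finite_singleton (cs.geomRep w⁻¹ (M.simpleRoot i)))).subset ?_
    rintro β ⟨h, h0, h1⟩
    rw [geomRep_mul_apply, geomRep_simple] at h1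
    rcases cs.nonneg_or_nonpos_of_mem_rootSet (cs.geomRep_mem_rootSet w h) with hw | hw
    · right
      have := cs.eq_simpleRoot_of_simpleReflection_nonpos (cs.geomRep_mem_rootSet w h) hw h1
      rw [Set.mem_singleton_iff, ← this, ← geomRep_mul_apply]
      simp
    · exact Or.inl ⟨h, h0, hw⟩

theorem finite_of_finite_rootSet [Finite B] (h : cs.rootSet.Finite) : Finite W := by
  have := h.to_subtype
  refine Finite.of_injective
    (fun (w : W) (i : B) => (⟨_, w, i, rfl⟩ : cs.rootSet)) fun x y hxy => ?_
  have hxy' : ∀ i, cs.geomRep x (M.simpleRoot i) = cs.geomRep y (M.simpleRoot i) := fun i =>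
    congrArg Subtype.val (congrFun hxy i)
  rw [← inv_mul_eq_one]
  refine cs.eq_one_of_geomRep_simpleRoot_eq fun i => ?_
  rw [geomRep_mul_apply, ← hxy', ← geomRep_mul_apply]
  simp

/-- The image of the simple root lies in the `-1`-eigenspace of its reflection, which is a line, and
it is again a root. -/
theorem geomRep_simpleRoot_of_commute {x : W} {i : B} (hx : x * cs.simple i = cs.simple i * x) :
    cs.geomRep x (M.simpleRoot i) = M.simpleRoot i ∨
      cs.geomRep x (M.simpleRoot i) = -M.simpleRoot i := by
  set y := cs.geomRep x (M.simpleRoot i) with hy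
  have h1 : M.simpleReflection i y = -y := by
    rw [hy, ← geomRep_simple cs, ← geomRep_mul_apply, ← hx, geomRep_mul_apply, geomRep_simple,
      M.simpleReflection_simpleRoot, map_neg]
  have h2 : y = (M.coroot i y / 2) • M.simpleRoot i := by
    rw [M.simpleReflection_apply] at h1
    have h2 : (2 : ℝ) • y = M.coroot i y • M.simpleRoot i := by
      rw [sub_eq_iff_eq_add] at h1
      rw [two_smul]
      nth_rw 1 [h1]
      abel
    rw [div_eq_inv_mul, mul_smul, ← h2, smul_smul]
    norm_num
  have h3 : y ∈ cs.rootSet := ⟨x, i, rfl⟩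
  rw [h2] at h3
  rcases cs.eq_or_eq_neg_of_mem_rootSet h3 with hc | hc <;> rw [h2, hc] <;> simp

/-- The centre of a Coxeter group has exponent two. -/
theorem mul_self_eq_one_of_mem_center (cs : CoxeterSystem M W) {z : W}
    (hz : z ∈ Subgroup.center W) : z * z = 1 := by
  refine cs.eq_one_of_geomRep_simpleRoot_eq fun i => ?_
  rw [geomRep_mul_apply]
  rcases cs.geomRep_simpleRoot_of_commute (Subgroup.mem_center_iff.1 hz (cs.simple i)).symm
    with h | h <;> simp [h]

/-- In the connected case, an invariant subspace of the geometric representation is either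
everything or fixed pointwise. -/
theorem eq_top_or_fixed_of_invariant (hM : (coxeterDiagram M).Connected) (U : Submodule ℝ (B →₀ ℝ))
    (hU : ∀ w, ∀ v ∈ U, cs.geomRep w v ∈ U) :
    U = ⊤ ∨ ∀ v ∈ U, ∀ w, cs.geomRep w v = v := by
  have hroot : ∀ v ∈ U, ∀ i, M.coroot i v ≠ 0 → M.simpleRoot i ∈ U := by
    intro v hv i hi
    have h1 := U.sub_mem hv (hU (cs.simple i) v hv)
    rw [geomRep_simple, M.simpleReflection_apply, sub_sub_cancel] at h1
    exact (U.smul_mem_iff hi).1 h1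
  -- Once `U` contains one simple root it contains its neighbours, hence all of them. If instead all
  -- coroots vanish on `U`, every simple reflection fixes it.
  by_cases h : ∃ v ∈ U, ∃ i, M.coroot i v ≠ 0
  · left
    obtain ⟨v, hv, i, hi⟩ := h
    have hall : ∀ j, M.simpleRoot j ∈ U := by
      intro j
      have hr : Relation.ReflTransGen (coxeterDiagram M).Adj i j :=
        (SimpleGraph.reachable_iff_reflTransGen i j).1 (hM.preconnected i j)
      induction hr with
      | refl => exact hroot v hv i hi
      | tail _ hadj ih =>
        refine hroot _ ih _ ?_
        rw [M.coroot_simpleRoot]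
        exact M.cartan_ne_zero (by rw [M.symmetric]; exact hadj.2)
    rw [eq_top_iff]
    intro x _
    induction x using Finsupp.induction_linear with
    | zero => exact U.zero_mem
    | add f g hf hg => exact U.add_mem (hf trivial) (hg trivial)
    | single j c =>
      have := U.smul_mem c (hall j)
      simpa [CoxeterMatrix.simpleRoot] using this
  · right
    push Not at h
    intro v hv w
    induction w using cs.simple_induction_left with
    | one => simp
    | mul_simple_left w i ih =>
      rw [geomRep_mul_apply, ih, geomRep_simple, M.simpleReflection_apply, h v hv i, zero_smul,
        sub_zero]

/-- An infinite Coxeter group with connected diagram has no nontrivial finite normal subgroup. -/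
theorem eq_bot_of_finite_normal (cs : CoxeterSystem M W) (hM : (coxeterDiagram M).Connected) [Finite B] [Infinite W] (N : Subgroup W) [N.Normal] [Finite N] :
    N = ⊥ := by
  classical
  have := Fintype.ofFinite N
  -- The vectors fixed by `N`, an invariant subspace because `N` is normal. The aim is `U = ⊤`, so
  -- that faithfulness gives `N = ⊥`.
  let U : Submodule ℝ (B →₀ ℝ) := ⨅ n : N, LinearMap.eqLocus (cs.geomRep n).toLinearMap LinearMap.id
  have memU : ∀ v, v ∈ U ↔ ∀ n ∈ N, cs.geomRep n v = v := by
    intro v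
    simp [U]
  have hU : ∀ w, ∀ v ∈ U, cs.geomRep w v ∈ U := by
    intro w v hv
    rw [memU] at hv ⊢
    intro n hn
    have h1 := hv (w⁻¹ * n * w) (by
      simpa using (inferInstance : N.Normal).conj_mem n hn w⁻¹)
    rw [← geomRep_mul_apply]
    conv_rhs => rw [← h1]
    rw [← geomRep_mul_apply]
    congr 2
    group
  have hsumU : ∀ β, ∑ n : N, cs.geomRep n β ∈ U := by
    intro β
    rw [memU]
    intro m hm
    rw [map_sum]
    simp_rw [← geomRep_mul_apply]
    exact Fintype.sum_equiv (Equiv.mulLeft (⟨m, hm⟩ : N)) _ _ fun n => rfl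
  -- If all sums over `N` vanished, every positive root would be made negative by some element of
  -- `N`. Finiteness of inversion sets would leave finitely many roots, and `W` would be finite.
  obtain ⟨β, hβ, hne⟩ : ∃ β ∈ cs.rootSet, ∑ n : N, cs.geomRep n β ≠ 0 := by
    by_contra! hcon
    have hneg : ∀ β ∈ cs.rootSet, 0 ≤ β → ∃ n : N, cs.geomRep n β ≤ 0 := by
      intro β hβ h0
      by_contra! hall
      have hall' : ∀ n : N, 0 ≤ cs.geomRep n β := fun n =>
        (cs.nonneg_or_nonpos_of_mem_rootSet (cs.geomRep_mem_rootSet n hβ)).resolve_right (hall n)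
      have := (Finset.sum_eq_zero_iff_of_nonneg (fun n _ => hall' n)).1 (hcon β hβ) 1
        (Finset.mem_univ _)
      exact cs.ne_zero_of_mem_rootSet hβ (by simpa using this)
    have hfin : (⋃ n : N, {β | β ∈ cs.rootSet ∧ 0 ≤ β ∧ cs.geomRep n β ≤ 0}).Finite :=
      Set.finite_iUnion fun n => cs.finite_inversions n
    refine not_finite_iff_infinite.2 ‹Infinite W› (cs.finite_of_finite_rootSet
      ((hfin.union (hfin.image Neg.neg)).subset fun β hβ => ?_))
    rcases cs.nonneg_or_nonpos_of_mem_rootSet hβ with h | h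
    · obtain ⟨n, hn⟩ := hneg β hβ h
      exact Or.inl (Set.mem_iUnion.2 ⟨n, hβ, h, hn⟩)
    · obtain ⟨n, hn⟩ := hneg (-β) (cs.neg_mem_rootSet hβ) (neg_nonneg.2 h)
      exact Or.inr ⟨-β, Set.mem_iUnion.2 ⟨n, cs.neg_mem_rootSet hβ, neg_nonneg.2 h, hn⟩, neg_neg β⟩
  -- Otherwise `W` fixes the sum over `N` of the images of `β`. But the reflection `τ` in `β`
  -- negates it, since conjugation by `τ` permutes `N`.
  have htop : U = ⊤ := by
    refine (cs.eq_top_or_fixed_of_invariant hM U hU).resolve_right fun hfix => hne ?_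
    obtain ⟨x, i, rfl⟩ := hβ
    set τ := x * cs.simple i * x⁻¹ with hτ
    have hτβ : cs.geomRep τ (cs.geomRep x (M.simpleRoot i)) = -cs.geomRep x (M.simpleRoot i) := by
      rw [← geomRep_mul_apply, hτ, inv_mul_cancel_right, geomRep_mul_apply, geomRep_simple,
        M.simpleReflection_simpleRoot, map_neg]
    set β := cs.geomRep x (M.simpleRoot i)
    have h1 := hfix _ (hsumU β) τ
    have h2 : cs.geomRep τ (∑ n : N, cs.geomRep n β) = -∑ n : N, cs.geomRep n β := by
      rw [map_sum, ← Finset.sum_neg_distrib]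
      refine Fintype.sum_equiv (MulAut.conjNormal (H := N) τ).toEquiv _ _ fun n => ?_
      rw [← map_neg, ← hτβ, ← geomRep_mul_apply, ← geomRep_mul_apply]
      simp [MulAut.conjNormal_apply, β]
    exact self_eq_neg.1 (h1.symm.trans h2)
  rw [Subgroup.eq_bot_iff_forall]
  intro n hn
  refine cs.eq_one_of_geomRep_simpleRoot_eq fun i => ?_
  exact (memU _).1 (htop ▸ Submodule.mem_top) n hn

/-- A central element squares to `1`, so it generates a finite normal subgroup. -/
theorem center_eq_bot (cs : CoxeterSystem M W) (hM : (coxeterDiagram M).Connected) [Finite B] [Infinite W] : Subgroup.center W = ⊥ := by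
  rw [Subgroup.eq_bot_iff_forall]
  intro z hz
  have hnorm : (Subgroup.zpowers z).Normal := ⟨fun n hn g => by
    have hn' : n ∈ Subgroup.center W := (Subgroup.zpowers_le.2 hz) hn
    rwa [Subgroup.mem_center_iff.1 hn' g, mul_inv_cancel_right]⟩
  have hfin : Finite (Subgroup.zpowers z) :=
    Nat.finite_of_card_ne_zero (by
      rw [Nat.card_zpowers]
      exact (orderOf_pos_iff.2 (isOfFinOrder_iff_pow_eq_one.2
        ⟨2, two_pos, by rw [pow_two, cs.mul_self_eq_one_of_mem_center hz]⟩)).ne')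
  exact Subgroup.zpowers_eq_bot.1 (cs.eq_bot_of_finite_normal hM _)

end CoxeterSystem

/-! ### Direct indecomposability of infinite irreducible Coxeter groups -/

/-- `G` is the internal direct product of its subgroups `C` and `D`. -/
structure Subgroup.IsInternalProd {G : Type*} [Group G] (C D : Subgroup G) : Prop where
  commute : ∀ c ∈ C, ∀ d ∈ D, c * d = d * c
  disjoint : ∀ x ∈ C, x ∈ D → x = 1
  exists_mul : ∀ g, ∃ c ∈ C, ∃ d ∈ D, g = c * d

namespace CoxeterSystem

variable {B : Type*} {M : CoxeterMatrix B} {W : Type*} [Group W] (cs : CoxeterSystem M W)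

/-- The subspace on which the elements of a subgroup `K` act through the scalars `lam`. -/
noncomputable def scalarSubmodule (K : Subgroup W) (lam : W → ℝ) : Submodule ℝ (B →₀ ℝ) :=
  ⨅ k : K, LinearMap.eqLocus (cs.geomRep k).toLinearMap (lam k • LinearMap.id)

theorem mem_scalarSubmodule {K : Subgroup W} {lam : W → ℝ} {v : B →₀ ℝ} :
    v ∈ cs.scalarSubmodule K lam ↔ ∀ k ∈ K, cs.geomRep k v = lam k • v := by
  simp [scalarSubmodule]

theorem scalarSubmodule_invariant {C D : Subgroup W} (hCD : C.IsInternalProd D) (lam : W → ℝ)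
    (w : W) {v : B →₀ ℝ} (hv : v ∈ cs.scalarSubmodule C lam) :
    cs.geomRep w v ∈ cs.scalarSubmodule C lam := by
  obtain ⟨c, hc, d, hd, rfl⟩ := hCD.exists_mul w
  rw [mem_scalarSubmodule] at *
  intro k hk
  have e1 : cs.geomRep (c * d) v = lam c • cs.geomRep d v := by
    rw [hCD.commute c hc d hd, geomRep_mul_apply, hv c hc, map_smul]
  rw [e1, map_smul, ← geomRep_mul_apply, hCD.commute k hk d hd, geomRep_mul_apply, hv k hk,
    map_smul, smul_comm]

theorem eq_bot_of_scalarSubmodule_eq_top (cs : CoxeterSystem M W)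
    (hZ : Subgroup.center W = ⊥) {K : Subgroup W} {lam : W → ℝ}
    (h : cs.scalarSubmodule K lam = ⊤) : K = ⊥ := by
  rw [eq_bot_iff, ← hZ]
  intro k hk
  rw [Subgroup.mem_center_iff]
  intro g
  refine cs.geomRep_injective ?_
  have hs : ∀ v, cs.geomRep k v = lam k • v := fun v =>
    cs.mem_scalarSubmodule.1 (h ▸ Submodule.mem_top) k hk
  ext1 v
  rw [geomRep_mul_apply, geomRep_mul_apply, hs, hs, map_smul]

/-- Write `w α = lam w • α + v w` with `v w` in the kernel of the coroot. For `c ∈ C` and `d ∈ D`,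
comparing `c d α` with `d c α` yields a vector `L` with `L = lam d • v c - d (v c) = lam c • v d - c
(v d)`. The first form is fixed by `a`, the second negated by `b`; so the reflection negates `L`,
making it a multiple of `α`, which `a` negates. Hence `L = 0` and `C` acts on each `v d` by the
scalars `lam`. If some `v d ≠ 0`, the space of such vectors is invariant and not fixed by `a`, so it
is everything and `C` is central. If all `v d` vanish, the same argument with `α` in place of `v d`
shows that `D` is central. -/
theorem eq_bot_or_eq_bot_of_factorization (cs : CoxeterSystem M W)
    (hM : (coxeterDiagram M).Connected) (hZ : Subgroup.center W = ⊥) {C D : Subgroup W}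
    (hCD : C.IsInternalProd D) (hDC : D.IsInternalProd C) {i : B} {a b : W} (ha : a ∈ C)
    (hb : b ∈ D) (hab : cs.simple i = a * b)
    (haα : cs.geomRep a (M.simpleRoot i) = -M.simpleRoot i)
    (hbα : cs.geomRep b (M.simpleRoot i) = M.simpleRoot i) : C = ⊥ ∨ D = ⊥ := by
  set α := M.simpleRoot i with hα
  have hσ : ∀ v, cs.geomRep a (cs.geomRep b v) = v - M.coroot i v • α := by
    intro v
    rw [← geomRep_mul_apply, ← hab, geomRep_simple, M.simpleReflection_apply]
  have hσ' : ∀ v, cs.geomRep b (cs.geomRep a v) = v - M.coroot i v • α := by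
    intro v
    rw [← hσ, ← geomRep_mul_apply, ← geomRep_mul_apply, hCD.commute a ha b hb]
  let lam : W → ℝ := fun w => M.coroot i (cs.geomRep w α) / 2
  have two_lam : ∀ w, M.coroot i (cs.geomRep w α) = 2 * lam w := fun w => by simp [lam]; ring
  let v : W → (B →₀ ℝ) := fun w => cs.geomRep w α - lam w • α
  have hv : ∀ w, cs.geomRep w α = lam w • α + v w := fun w => by simp [v]
  have hCb : ∀ c ∈ C, cs.geomRep b (cs.geomRep c α) = cs.geomRep c α := by
    intro c hc
    rw [← geomRep_mul_apply, ← hCD.commute c hc b hb, geomRep_mul_apply, hbα]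
  have hDa : ∀ d ∈ D, cs.geomRep a (cs.geomRep d α) = -cs.geomRep d α := by
    intro d hd
    rw [← geomRep_mul_apply, hCD.commute a ha d hd, geomRep_mul_apply, haα, map_neg]
  have hva : ∀ c ∈ C, cs.geomRep a (v c) = v c := by
    intro c hc
    have h1 := hσ (cs.geomRep c α)
    rw [hCb c hc, two_lam] at h1
    simp only [v, map_sub, map_smul, h1, haα]
    module
  have hub : ∀ d ∈ D, cs.geomRep b (v d) = -v d := by
    intro d hd
    have h1 := hσ' (cs.geomRep d α)
    rw [hDa d hd, two_lam, map_neg] at h1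
    simp only [v, map_sub, map_smul, neg_eq_iff_eq_neg.1 h1, hbα]
    module
  have hua : ∀ d ∈ D, cs.geomRep a (v d) = -v d := by
    intro d hd
    simp only [v, map_sub, map_smul, hDa d hd, haα]
    module
  have hcu : ∀ c ∈ C, ∀ d ∈ D, cs.geomRep c (v d) = lam c • v d := by
    intro c hc d hd
    have hcomm : cs.geomRep c (cs.geomRep d α) = cs.geomRep d (cs.geomRep c α) := by
      rw [← geomRep_mul_apply, hCD.commute c hc d hd, geomRep_mul_apply]
    rw [hv c, hv d] at hcomm
    simp only [map_add, map_smul, hv c, hv d] at hcomm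
    set L := lam d • v c - cs.geomRep d (v c) with hL
    have hLR : L = lam c • v d - cs.geomRep c (v d) := by
      have : L - (lam c • v d - cs.geomRep c (v d)) =
          (lam d • (lam c • α + v c) + cs.geomRep c (v d)) -
            (lam c • (lam d • α + v d) + cs.geomRep d (v c)) := by
        rw [hL]; module
      rw [← sub_eq_zero, this, hcomm, sub_self]
    have hLa : cs.geomRep a L = L := by
      rw [hL, map_sub, map_smul, hva c hc, ← geomRep_mul_apply, hCD.commute a ha d hd,
        geomRep_mul_apply, hva c hc]
    have hRb : cs.geomRep b L = -L := by
      rw [hLR, map_sub, map_smul, hub d hd, ← geomRep_mul_apply, ← hCD.commute c hc b hb,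
        geomRep_mul_apply, hub d hd, map_neg]
      module
    have hL2 : (2 : ℝ) • L = M.coroot i L • α := by
      have := hσ L
      rw [hRb, map_neg, hLa] at this
      rw [two_smul]
      nth_rw 1 [← neg_neg L]
      rw [this]
      abel
    have hL3 : (2 : ℝ) • L = -((2 : ℝ) • L) := by
      conv_lhs => rw [← hLa, ← map_smul, hL2, map_smul, haα]
      rw [hL2, smul_neg]
    have hL0 : L = 0 := by
      have := self_eq_neg.1 hL3
      simpa using this
    rw [hL0] at hLR
    exact (sub_eq_zero.1 hLR.symm).symm
  by_cases hex : ∃ d ∈ D, v d ≠ 0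
  · left
    obtain ⟨d, hd, hne⟩ := hex
    refine cs.eq_bot_of_scalarSubmodule_eq_top hZ (lam := lam) ?_
    refine (cs.eq_top_or_fixed_of_invariant hM _ fun w v hv =>
      cs.scalarSubmodule_invariant hCD lam w hv).resolve_right fun hfix => hne ?_
    have h1 := hfix (v d) (cs.mem_scalarSubmodule.2 fun c hc => hcu c hc d hd) a
    rw [hua d hd] at h1
    exact self_eq_neg.1 h1.symm
  · right
    push Not at hex
    refine cs.eq_bot_of_scalarSubmodule_eq_top hZ (lam := lam) ?_
    refine (cs.eq_top_or_fixed_of_invariant hM _ fun w v hv =>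
      cs.scalarSubmodule_invariant hDC lam w hv).resolve_right fun hfix => ?_
    have h1 := hfix α (cs.mem_scalarSubmodule.2 fun d hd => by
      rw [hv d, hex d hd, add_zero]) a
    rw [haα] at h1
    exact M.simpleRoot_ne_zero i (self_eq_neg.1 h1.symm)

theorem _root_.Subgroup.IsInternalProd.symm {G : Type*} [Group G] {C D : Subgroup G}
    (h : C.IsInternalProd D) : D.IsInternalProd C where
  commute d hd c hc := (h.commute c hc d hd).symm
  disjoint x hx hx' := h.disjoint x hx' hx
  exists_mul g := by
    obtain ⟨c, hc, d, hd, rfl⟩ := h.exists_mul g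
    exact ⟨d, hd, c, hc, h.commute c hc d hd⟩

/-- A centreless Coxeter group with connected diagram is not an internal direct product of two
nontrivial subgroups. -/
theorem eq_bot_or_eq_bot_of_isInternalProd (cs : CoxeterSystem M W)
    (hM : (coxeterDiagram M).Connected) (hZ : Subgroup.center W = ⊥) {C D : Subgroup W}
    (h : C.IsInternalProd D) : C = ⊥ ∨ D = ⊥ := by
  obtain ⟨i⟩ := hM.nonempty
  obtain ⟨a, ha, b, hb, hab⟩ := h.exists_mul (cs.simple i)
  have hcomm : a * b = b * a := h.commute a ha b hb
  have hα : cs.geomRep a (cs.geomRep b (M.simpleRoot i)) = -M.simpleRoot i := by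
    rw [← geomRep_mul_apply, ← hab, geomRep_simple, M.simpleReflection_simpleRoot]
  -- Both factors commute with the reflection, so each sends the simple root to plus or minus
  -- itself; exactly one of them negates it.
  rcases cs.geomRep_simpleRoot_of_commute (x := a) (by rw [hab, mul_assoc, hcomm]) with ha' | ha' <;>
    rcases cs.geomRep_simpleRoot_of_commute (x := b) (by rw [hab, ← mul_assoc, ← hcomm]) with hb' | hb'
  · rw [hb', ha'] at hα
    exact absurd (self_eq_neg.1 hα) (M.simpleRoot_ne_zero i)
  · exact (cs.eq_bot_or_eq_bot_of_factorization hM hZ h.symm h hb ha (hab.trans hcomm) hb' ha').symm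
  · exact cs.eq_bot_or_eq_bot_of_factorization hM hZ h h.symm ha hb hab ha' hb'
  · rw [hb', map_neg, ha', neg_neg] at hα
    exact absurd (self_eq_neg.1 hα) (M.simpleRoot_ne_zero i)

end CoxeterSystem

/-! ### Products of Coxeter systems and disconnected diagrams -/

namespace CoxeterMatrix

variable {B₁ B₂ : Type*}

/-- The Coxeter matrix of a product: entries between the two blocks are `2`. -/
def prod (M₁ : CoxeterMatrix B₁) (M₂ : CoxeterMatrix B₂) : CoxeterMatrix (B₁ ⊕ B₂) where
  M := Matrix.fromBlocks M₁.M (fun _ _ => 2) (fun _ _ => 2) M₂.M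
  isSymm := by
    refine Matrix.IsSymm.fromBlocks M₁.isSymm ?_ M₂.isSymm
    rfl
  diagonal i := by
    cases i
    · exact M₁.diagonal _
    · exact M₂.diagonal _
  off_diagonal i j h := by
    cases i <;> cases j
    · exact M₁.off_diagonal _ _ fun h' => h (congrArg _ h')
    · simp [Matrix.fromBlocks]
    · simp [Matrix.fromBlocks]
    · exact M₂.off_diagonal _ _ fun h' => h (congrArg _ h')

variable (M₁ : CoxeterMatrix B₁) (M₂ : CoxeterMatrix B₂)

@[simp] theorem prod_inl_inl (i j : B₁) : M₁.prod M₂ (.inl i) (.inl j) = M₁ i j := rfl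
@[simp] theorem prod_inl_inr (i : B₁) (j : B₂) : M₁.prod M₂ (.inl i) (.inr j) = 2 := rfl
@[simp] theorem prod_inr_inl (i : B₂) (j : B₁) : M₁.prod M₂ (.inr i) (.inl j) = 2 := rfl
@[simp] theorem prod_inr_inr (i j : B₂) : M₁.prod M₂ (.inr i) (.inr j) = M₂ i j := rfl

end CoxeterMatrix

namespace CoxeterSystem

variable {B₁ B₂ : Type*} {M₁ : CoxeterMatrix B₁} {M₂ : CoxeterMatrix B₂}

theorem commute_simple_of_eq_two {B W : Type*} [Group W] {M : CoxeterMatrix B}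
    (cs : CoxeterSystem M W) {i j : B} (h : M i j = 2) :
    Commute (cs.simple i) (cs.simple j) := by
  have := cs.simple_mul_simple_pow i j
  rw [h, pow_two] at this
  have h2 := eq_inv_of_mul_eq_one_left this
  rwa [mul_inv_rev, inv_simple, inv_simple] at h2

/-- The product of two Coxeter systems. -/
noncomputable def prod {W₁ W₂ : Type*} [Group W₁] [Group W₂] (cs₁ : CoxeterSystem M₁ W₁)
    (cs₂ : CoxeterSystem M₂ W₂) : CoxeterSystem (M₁.prod M₂) (W₁ × W₂) := by
  let cs := (M₁.prod M₂).toCoxeterSystem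
  let f : B₁ ⊕ B₂ → W₁ × W₂ := Sum.elim (fun i => (cs₁.simple i, 1)) (fun j => (1, cs₂.simple j))
  have hf : (M₁.prod M₂).IsLiftable f := by
    rintro (i | i) (j | j) <;> simp [f, Prod.ext_iff]
  let φ : (M₁.prod M₂).Group →* W₁ × W₂ := cs.lift ⟨f, hf⟩
  have h₁ : M₁.IsLiftable (fun i => cs.simple (.inl i)) := fun i j =>
    cs.simple_mul_simple_pow (.inl i) (.inl j)
  have h₂ : M₂.IsLiftable (fun i => cs.simple (.inr i)) := fun i j =>
    cs.simple_mul_simple_pow (.inr i) (.inr j)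
  let g₁ : W₁ →* (M₁.prod M₂).Group := cs₁.lift ⟨_, h₁⟩
  let g₂ : W₂ →* (M₁.prod M₂).Group := cs₂.lift ⟨_, h₂⟩
  have hg₁ : ∀ i, g₁ (cs₁.simple i) = cs.simple (.inl i) := cs₁.lift_apply_simple h₁
  have hg₂ : ∀ i, g₂ (cs₂.simple i) = cs.simple (.inr i) := cs₂.lift_apply_simple h₂
  have hcomm' : ∀ i y, Commute (g₁ (cs₁.simple i)) (g₂ y) := by
    intro i y
    induction y using cs₂.simple_induction_left with
    | one => simp
    | mul_simple_left y j hy =>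
      rw [map_mul]
      refine Commute.mul_right ?_ hy
      rw [hg₁, hg₂]
      exact cs.commute_simple_of_eq_two (M₁.prod_inl_inr M₂ _ _)
  have hcomm : ∀ x y, Commute (g₁ x) (g₂ y) := by
    intro x y
    induction x using cs₁.simple_induction_left with
    | one => simp
    | mul_simple_left x i hx =>
      rw [map_mul]
      exact (hcomm' i y).mul_left hx
  let ψ : W₁ × W₂ →* (M₁.prod M₂).Group := MonoidHom.noncommCoprod g₁ g₂ hcomm
  have hφψ : φ.comp ψ = MonoidHom.id _ := by
    have e₁ : φ.comp g₁ = MonoidHom.inl W₁ W₂ := cs₁.ext_simple fun i => by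
      simp [hg₁, φ, f]
    have e₂ : φ.comp g₂ = MonoidHom.inr W₁ W₂ := cs₂.ext_simple fun i => by
      simp [hg₂, φ, f]
    rw [MonoidHom.comp_noncommCoprod]
    simp only [e₁, e₂]
    exact MonoidHom.noncommCoprod_inl_inr
  have hψφ : ψ.comp φ = MonoidHom.id _ := by
    refine cs.ext_simple fun i => ?_
    cases i <;> simp [φ, ψ, f, hg₁, hg₂]
  exact ⟨(MonoidHom.toMulEquiv φ ψ hψφ hφψ).symm⟩

end CoxeterSystem

/-- The component of a vertex and its complement are two proper blocks with all mixed entries equal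
to `2`. -/
theorem CoxeterMatrix.exists_prod_of_not_connected {n : ℕ} (M : CoxeterMatrix (Fin n))
    (hn : 0 < n) (h : ¬ (coxeterDiagram M).Connected) :
    ∃ (k l : ℕ) (M₁ : CoxeterMatrix (Fin k)) (M₂ : CoxeterMatrix (Fin l)), k < n ∧ l < n ∧
      Nonempty (M.Group ≃* M₁.Group × M₂.Group) := by
  classical
  have := Fin.pos_iff_nonempty.1 hn
  obtain ⟨i₀, j₀, hij⟩ : ∃ i j, ¬ (coxeterDiagram M).Reachable i j := by
    by_contra! hcon
    exact h ⟨hcon⟩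
  let A : Fin n → Prop := fun j => (coxeterDiagram M).Reachable i₀ j
  have hA : ∀ i j, A i → ¬ A j → M i j = 2 := by
    intro i j hi hj
    by_contra h2
    refine hj (hi.trans (SimpleGraph.Adj.reachable ⟨?_, h2⟩))
    rintro rfl
    exact hj hi
  let e₁ := Fintype.equivFin {i // A i}
  let e₂ := Fintype.equivFin {i // ¬ A i}
  let e : Fin n ≃ Fin (Fintype.card {i // A i}) ⊕ Fin (Fintype.card {i // ¬ A i}) :=
    (Equiv.sumCompl A).symm.trans (Equiv.sumCongr e₁ e₂)
  let M₁ : CoxeterMatrix (Fin (Fintype.card {i // A i})) :=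
    { M := fun i j => M (e₁.symm i) (e₁.symm j)
      isSymm := by ext i j; exact M.symmetric _ _
      diagonal := fun i => M.diagonal _
      off_diagonal := fun i j h => M.off_diagonal _ _ (by simpa [Subtype.val_inj] using h) }
  let M₂ : CoxeterMatrix (Fin (Fintype.card {i // ¬ A i})) :=
    { M := fun i j => M (e₂.symm i) (e₂.symm j)
      isSymm := by ext i j; exact M.symmetric _ _
      diagonal := fun i => M.diagonal _
      off_diagonal := fun i j h => M.off_diagonal _ _ (by simpa [Subtype.val_inj] using h) }
  have hMe : M.reindex e = M₁.prod M₂ := by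
    refine CoxeterMatrix.ext ?_
    ext i j
    change M (e.symm i) (e.symm j) = _
    rcases i with i | i <;> rcases j with j | j
    · rfl
    · exact hA _ _ (e₁.symm i).2 (e₂.symm j).2
    · rw [M.symmetric]
      exact hA _ _ (e₁.symm j).2 (e₂.symm i).2
    · rfl
  have cs := M.toCoxeterSystem.reindex e
  rw [hMe] at cs
  refine ⟨_, _, M₁, M₂, ?_, ?_, ⟨cs.mulEquiv.trans
    (M₁.toCoxeterSystem.prod M₂.toCoxeterSystem).mulEquiv.symm⟩⟩
  · simpa using Fintype.card_subtype_lt (p := A) (x := j₀) hij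
  · simpa using Fintype.card_subtype_lt (p := fun i => ¬ A i) (x := i₀)
      (not_not.2 (SimpleGraph.Reachable.refl i₀))

theorem IsFinRankCoxeterGroup.of_mulEquiv {W : Type*} {W' : Type*} [Group W] [Group W']
    (h : IsFinRankCoxeterGroup W) (e : W ≃* W') : IsFinRankCoxeterGroup W' := by
  obtain ⟨n, M, ⟨cs⟩⟩ := h
  exact ⟨n, M, ⟨cs.map e⟩⟩

theorem IsFinRankCoxeterGroup.prod {W₁ : Type*} {W₂ : Type*} [Group W₁] [Group W₂]
    (h₁ : IsFinRankCoxeterGroup W₁) (h₂ : IsFinRankCoxeterGroup W₂) :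
    IsFinRankCoxeterGroup (W₁ × W₂) := by
  obtain ⟨n₁, M₁, ⟨cs₁⟩⟩ := h₁
  obtain ⟨n₂, M₂, ⟨cs₂⟩⟩ := h₂
  exact ⟨_, _, ⟨(cs₁.prod cs₂).reindex finSumFinEquiv⟩⟩

theorem IsFinRankCoxeterGroup.of_subsingleton (W : Type*) [Group W] [Subsingleton W] :
    IsFinRankCoxeterGroup W := by
  let M : CoxeterMatrix (Fin 0) :=
    { M := 0, isSymm := by ext i; exact i.elim0, diagonal := fun i => i.elim0,
      off_diagonal := fun i => i.elim0 }
  have : Subsingleton M.Group := by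
    refine ⟨fun x y => ?_⟩
    have : ∀ x : M.Group, x = 1 := fun x => by
      induction x using M.toCoxeterSystem.simple_induction_left with
      | one => rfl
      | mul_simple_left _ i _ => exact i.elim0
    rw [this x, this y]
  exact ⟨0, M, ⟨⟨1, 1, fun _ => Subsingleton.elim _ _, fun _ => Subsingleton.elim _ _⟩,
    fun _ _ => Subsingleton.elim _ _⟩⟩

/-! ### First-order formulas on groups and definable quotients -/

open FirstOrder Language

namespace GroupFormula

variable {α β ι : Type*} {G : Type*} [Group G]

/-- The term `1`. -/
def one : groupLanguage.Term α := Term.func (L := groupLanguage) GroupFunc.one ![]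

/-- The term `t⁻¹`. -/
def inv (t : groupLanguage.Term α) : groupLanguage.Term α :=
  Term.func (L := groupLanguage) GroupFunc.inv ![t]

/-- The term `s * t`. -/
def mul (s t : groupLanguage.Term α) : groupLanguage.Term α :=
  Term.func (L := groupLanguage) GroupFunc.mul ![s, t]

@[simp] theorem realize_one (v : α → G) : (one : groupLanguage.Term α).realize v = 1 := rfl

@[simp] theorem realize_inv (t : groupLanguage.Term α) (v : α → G) :
    (inv t).realize v = (t.realize v)⁻¹ := rfl

@[simp] theorem realize_mul (s t : groupLanguage.Term α) (v : α → G) :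
    (mul s t).realize v = s.realize v * t.realize v := rfl

/-- Universal quantification over one variable. -/
noncomputable def all (φ : groupLanguage.Formula (α ⊕ Unit)) : groupLanguage.Formula α :=
  Formula.iAlls Unit φ

/-- Existential quantification over one variable. -/
noncomputable def ex (φ : groupLanguage.Formula (α ⊕ Unit)) : groupLanguage.Formula α :=
  Formula.iExs Unit φ

@[simp] theorem realize_all {φ : groupLanguage.Formula (α ⊕ Unit)} {v : α → G} :
    (all φ).Realize v ↔ ∀ x : G, φ.Realize (Sum.elim v fun _ => x) := by
  rw [all, Formula.realize_iAlls]
  exact ⟨fun h x => h fun _ => x, fun h i => h (i ())⟩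

@[simp] theorem realize_ex {φ : groupLanguage.Formula (α ⊕ Unit)} {v : α → G} :
    (ex φ).Realize v ↔ ∃ x : G, φ.Realize (Sum.elim v fun _ => x) := by
  rw [ex, Formula.realize_iExs]
  exact ⟨fun ⟨i, h⟩ => ⟨i (), h⟩, fun ⟨x, h⟩ => ⟨fun _ => x, h⟩⟩

/-- The formula saying that `t` commutes with all terms of a finite family. -/
noncomputable def centralizes [Finite ι] (t : groupLanguage.Term α)
    (a : ι → groupLanguage.Term α) : groupLanguage.Formula α :=
  Formula.iInf fun i => (mul t (a i)).equal (mul (a i) t)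

@[simp] theorem realize_centralizes [Finite ι] {t : groupLanguage.Term α}
    {a : ι → groupLanguage.Term α} {v : α → G} :
    (centralizes t a).Realize v ↔
      ∀ i, t.realize v * (a i).realize v = (a i).realize v * t.realize v := by
  simp [centralizes]

/-- The product of the squares of a list of terms. -/
def prodSq (l : List (groupLanguage.Term α)) : groupLanguage.Term α :=
  l.foldr (fun t acc => mul (mul t t) acc) one

@[simp] theorem realize_prodSq (l : List (groupLanguage.Term α)) (v : α → G) :
    (prodSq l).realize v = (l.map fun t => t.realize v * t.realize v).prod := by
  induction l with
  | nil => rfl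
  | cons t l ih => simpa [prodSq] using ih

/-- The translation of formulas about the quotient by the normal subgroup defined by `ν` into
formulas about the group: equality is replaced by congruence modulo that subgroup. -/
def quotient (ν : groupLanguage.Formula (α ⊕ Unit)) :
    ∀ {n : ℕ}, groupLanguage.BoundedFormula Empty n → groupLanguage.BoundedFormula α n
  | _, .falsum => .falsum
  | n, .equal s t =>
    BoundedFormula.relabel (k := 0) (n := n) id
      (ν.subst (Sum.elim (fun a => Term.var (Sum.inl a))
        fun _ => (mul (inv s) t).relabel (Sum.map Empty.elim id)))
  | _, .rel R _ => Empty.elim R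
  | _, .imp φ ψ => (quotient ν φ).imp (quotient ν ψ)
  | _, .all φ => (quotient ν φ).all

theorem realize_term_quotient (N : Subgroup G) [N.Normal] (t : groupLanguage.Term β)
    (v : β → G) : t.realize (fun b => (v b : G ⧸ N)) = ((t.realize v : G) : G ⧸ N) := by
  induction t with
  | var => rfl
  | func f ts ih =>
    cases f with
    | one => rfl
    | inv =>
      change (Term.realize _ (ts 0))⁻¹ = _
      rw [ih]
      rfl
    | mul =>
      change Term.realize _ (ts 0) * Term.realize _ (ts 1) = _
      rw [ih, ih]
      rfl

theorem realize_quotient {ν : groupLanguage.Formula (α ⊕ Unit)} {p : α → G} {N : Subgroup G}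
    [N.Normal] (hν : ∀ x, ν.Realize (Sum.elim p fun _ => x) ↔ x ∈ N) {n : ℕ}
    (φ : groupLanguage.BoundedFormula Empty n) (xs : Fin n → G) (e : Empty → G ⧸ N) :
    (quotient ν φ).Realize p xs ↔ φ.Realize e (fun i => (xs i : G ⧸ N)) := by
  induction φ with
  | falsum => rfl
  | equal s t =>
    have hv : (Sum.elim e fun i => (xs i : G ⧸ N)) =
        fun b => ((Sum.elim (fun x : Empty => x.elim) xs b : G) : G ⧸ N) := by
      funext b
      rcases b with b | b
      · exact b.elim
      · rfl
    change _ ↔ s.realize _ = t.realize _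
    rw [hv, realize_term_quotient, realize_term_quotient, QuotientGroup.eq, ← hν, quotient,
      BoundedFormula.realize_relabel, BoundedFormula.realize_subst, Formula.Realize]
    have hx : (xs ∘ Fin.natAdd _ : Fin 0 → G) = default := Subsingleton.elim _ _
    rw [hx]
    congr! 1
    funext a
    rcases a with a | a
    · rfl
    · simp only [Sum.elim_inr, Term.realize_relabel, realize_mul, realize_inv]
      congr! 3 <;>
      · funext b
        rcases b with b | b
        · exact b.elim
        · rfl
  | rel R => exact R.elim
  | imp φ ψ ih₁ ih₂ => exact imp_congr (ih₁ xs) (ih₂ xs)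
  | all φ ih =>
    have hsnoc : ∀ x : G, (fun i => ((Fin.snoc xs x : Fin _ → G) i : G ⧸ N)) =
        Fin.snoc (fun i => (xs i : G ⧸ N)) (x : G ⧸ N) := by
      intro x
      funext i
      refine Fin.lastCases ?_ (fun j => ?_) i <;> simp
    rw [quotient, BoundedFormula.realize_all, BoundedFormula.realize_all]
    constructor
    · intro h a
      obtain ⟨x, rfl⟩ := QuotientGroup.mk_surjective a
      rw [← hsnoc, ← ih]
      exact h x
    · intro h x
      rw [ih, hsnoc]
      exact h x

theorem realize_quotient_sentence {ν : groupLanguage.Formula (α ⊕ Unit)} {p : α → G}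
    {N : Subgroup G} [N.Normal] (hν : ∀ x, ν.Realize (Sum.elim p fun _ => x) ↔ x ∈ N)
    (φ : groupLanguage.Sentence) :
    Formula.Realize (quotient ν φ : groupLanguage.Formula α) p ↔ (G ⧸ N) ⊨ φ := by
  rw [Formula.Realize, realize_quotient hν φ _ default]
  rw [Sentence.Realize, Formula.Realize]
  exact iff_of_eq (congrArg₂ (BoundedFormula.Realize φ) (Subsingleton.elim _ _)
    (Subsingleton.elim _ _))

/-- The sentence saying that there are realizations of `θ`, indexed by `κ`, such that every
realization of `θ` is `ε`-related to one of them. -/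
noncomputable def hasTransversal [Finite α] (θ : groupLanguage.Formula α)
    (ε : groupLanguage.Formula (α ⊕ α)) (κ : Type*) [Finite κ] : groupLanguage.Sentence :=
  Formula.iExs (κ × α)
    ((Formula.iInf fun j : κ => θ.relabel fun a => Sum.inr (j, a)) ⊓
      Formula.iAlls α ((θ.relabel Sum.inr).imp
        (Formula.iSup fun j : κ => ε.relabel
          (Sum.elim Sum.inr fun a => Sum.inl (Sum.inr (j, a))))))

theorem realize_hasTransversal [Finite α] (θ : groupLanguage.Formula α)
    (ε : groupLanguage.Formula (α ⊕ α)) (κ : Type*) [Finite κ] :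
    G ⊨ hasTransversal θ ε κ ↔ ∃ s : κ → α → G, (∀ j, θ.Realize (s j)) ∧
      ∀ x, θ.Realize x → ∃ j, ε.Realize (Sum.elim x (s j)) := by
  have e₁ : ∀ (i : κ × α → G) (x : α → G) (j : κ),
      Sum.elim (Sum.elim (default : Empty → G) i) x ∘
        (Sum.elim Sum.inr fun a => Sum.inl (Sum.inr (j, a))) =
      Sum.elim x fun a => i (j, a) := by
    intro i x j
    funext a
    rcases a with a | a <;> rfl
  rw [Sentence.Realize, hasTransversal, Formula.realize_iExs, (Equiv.curry κ α G).exists_congr_left]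
  refine exists_congr fun s => ?_
  simp only [Formula.realize_inf, Formula.realize_iInf, Formula.realize_relabel,
    Formula.realize_iAlls, Formula.realize_imp, Formula.realize_iSup, e₁]
  rfl

/-- If `θ` has finitely many realizations in `W` up to the relation `ε`, then every realization of
`θ` in `W` is matched by one in `G` that satisfies the same `ε`-invariant formulas. -/
theorem exists_realization [Finite α] {W : Type*} [Group W]
    (h : ElementarilyEquivalentGroups G W) (θ : groupLanguage.Formula α)
    (ε : groupLanguage.Formula (α ⊕ α)) {κ : Type*} [Finite κ] (t : κ → α → W)
    (htθ : ∀ j, θ.Realize (t j))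
    (ht : ∀ x, θ.Realize x → ∃ j, ε.Realize (Sum.elim x (t j)))
    {b : α → W} (hb : θ.Realize b) (Ψ : Set (groupLanguage.Formula α))
    (hΨ : ∀ ψ ∈ Ψ, ∀ x y : α → G, θ.Realize x → θ.Realize y → ε.Realize (Sum.elim x y) →
      ψ.Realize x → ψ.Realize y)
    (hbΨ : ∀ ψ ∈ Ψ, ψ.Realize b) :
    ∃ a : α → G, θ.Realize a ∧ ∀ ψ ∈ Ψ, ψ.Realize a := by
  have h' := elementarilyEquivalent_iff.1 h
  obtain ⟨s, hsθ, hs⟩ := (realize_hasTransversal (G := G) θ ε κ).1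
    ((h' _).2 ((realize_hasTransversal (G := W) θ ε κ).2 ⟨t, htθ, ht⟩))
  -- `Ψ` may be infinite, but there are finitely many representatives `s j`. If each fails some `ψ
  -- j`, the conjunction of these holds at `b`, hence at some `x` in `G`; by invariance the
  -- representative of `x` satisfies its own `ψ j`.
  by_contra! hcon
  choose ψ hψ hψs using fun j => hcon (s j) (hsθ j)
  let χ : groupLanguage.Sentence :=
    Formula.iExs α ((θ ⊓ Formula.iInf ψ).relabel Sum.inr)
  have hW : W ⊨ χ := by
    rw [Sentence.Realize, Formula.realize_iExs]
    refine ⟨b, ?_⟩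
    rw [Formula.realize_relabel, Sum.elim_comp_inr, Formula.realize_inf, Formula.realize_iInf]
    exact ⟨hb, fun j => hbΨ _ (hψ j)⟩
  have hG := (h' χ).2 hW
  rw [Sentence.Realize, Formula.realize_iExs] at hG
  obtain ⟨x, hx⟩ := hG
  rw [Formula.realize_relabel, Sum.elim_comp_inr, Formula.realize_inf, Formula.realize_iInf] at hx
  obtain ⟨j, hj⟩ := hs x hx.1
  exact hψs j (hΨ _ (hψ j) x (s j) hx.1 (hsθ j) hj (hx.2 j))

end GroupFormula

/-! ### Internal direct products and complements modulo squares -/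

section Groups

variable {G : Type*} [Group G]

namespace Subgroup.IsInternalProd

variable {C D : Subgroup G}

theorem normal_left (h : C.IsInternalProd D) : C.Normal := ⟨fun x hx g => by
  obtain ⟨c, hc, d, hd, rfl⟩ := h.exists_mul g
  have : c * d * x * (c * d)⁻¹ = c * x * c⁻¹ := by
    rw [mul_assoc c d x, ← h.commute x hx d hd]
    group
  rw [this]
  exact C.mul_mem (C.mul_mem hc hx) (C.inv_mem hc)⟩

theorem normal_right (h : C.IsInternalProd D) : D.Normal := h.symm.normal_left

/-- An internal direct product is the product of the two quotients. -/
theorem nonempty_mulEquiv_quotient_prod (h : C.IsInternalProd D) [C.Normal] [D.Normal] :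
    Nonempty (G ≃* (G ⧸ C) × (G ⧸ D)) := by
  refine ⟨MulEquiv.ofBijective ((QuotientGroup.mk' C).prod (QuotientGroup.mk' D)) ⟨?_, ?_⟩⟩
  · refine (injective_iff_map_eq_one _).2 fun x hx => ?_
    simp only [MonoidHom.prod_apply, QuotientGroup.mk'_apply, Prod.mk_eq_one,
      QuotientGroup.eq_one_iff] at hx
    exact h.disjoint x hx.1 hx.2
  · rintro ⟨x, y⟩
    obtain ⟨x, rfl⟩ := QuotientGroup.mk_surjective x
    obtain ⟨y, rfl⟩ := QuotientGroup.mk_surjective y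
    obtain ⟨c, hc, d, hd, rfl⟩ := h.exists_mul x
    obtain ⟨c', hc', d', hd', rfl⟩ := h.exists_mul y
    refine ⟨c' * d, Prod.ext ?_ ?_⟩
    · refine QuotientGroup.eq.2 ?_
      have : (c' * d)⁻¹ * (c * d) = d⁻¹ * (c'⁻¹ * c) * d⁻¹⁻¹ := by group
      rw [this]
      exact h.normal_left.conj_mem _ (C.mul_mem (C.inv_mem hc') hc) _
    · refine QuotientGroup.eq.2 ?_
      have : (c' * d)⁻¹ * (c' * d') = d⁻¹ * d' := by group
      rw [this]
      exact D.mul_mem (D.inv_mem hd) hd'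

/-- The first factor of an internal direct product is the quotient by the second. -/
theorem nonempty_mulEquiv_quotient (h : C.IsInternalProd D) [D.Normal] :
    Nonempty (C ≃* G ⧸ D) := by
  refine ⟨MulEquiv.ofBijective ((QuotientGroup.mk' D).comp C.subtype) ⟨?_, ?_⟩⟩
  · refine (injective_iff_map_eq_one _).2 fun x hx => Subtype.ext ?_
    exact h.disjoint x x.2 ((QuotientGroup.eq_one_iff _).1 hx)
  · intro x
    obtain ⟨x, rfl⟩ := QuotientGroup.mk_surjective x
    obtain ⟨c, hc, d, hd, rfl⟩ := h.exists_mul x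
    refine ⟨⟨c, hc⟩, QuotientGroup.eq.2 ?_⟩
    simpa using hd

end Subgroup.IsInternalProd

/-- A subgroup meeting the subgroup generated by squares trivially has a complement. -/
theorem exists_complement_of_disjoint_squares (Z : Subgroup G)
    (hZ : ∀ z ∈ Z, z ∈ Subgroup.closure (Set.range fun y : G => y * y) → z = 1) :
    ∃ H : Subgroup G, (∀ z ∈ Z, z ∈ H → z = 1) ∧ ∀ g, ∃ z ∈ Z, ∃ h ∈ H, g = z * h := by
  let P : Set (Subgroup G) := {H | (∀ y, y * y ∈ H) ∧ ∀ z ∈ Z, z ∈ H → z = 1}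
  obtain ⟨H, -, hH⟩ := zorn_le_nonempty₀ P (by
    intro c hc hchain H₀ hH₀
    refine ⟨sSup c, ⟨fun y => ?_, fun z hz hzc => ?_⟩, fun K hK => le_sSup hK⟩
    · exact le_sSup hH₀ ((hc hH₀).1 y)
    · obtain ⟨K, hK, hzK⟩ := (Subgroup.mem_sSup_of_directedOn ⟨H₀, hH₀⟩ hchain.directedOn).1 hzc
      exact (hc hK).2 z hz hzK)
    (Subgroup.closure (Set.range fun y : G => y * y))
    ⟨fun y => Subgroup.subset_closure ⟨y, rfl⟩, hZ⟩
  obtain ⟨hsq, hdisj⟩ := hH.prop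
  have hconj : ∀ x ∈ H, ∀ a, a * x * a⁻¹ ∈ H := by
    intro x hx a
    have : a * x * a⁻¹ =
        (a * x) * (a * x) * ((x⁻¹ * a⁻¹ * x) * (x⁻¹ * a⁻¹ * x)) * x⁻¹ := by group
    rw [this]
    exact H.mul_mem (H.mul_mem (hsq _) (hsq _)) (H.inv_mem hx)
  refine ⟨H, hdisj, fun y => ?_⟩
  by_cases hy : y ∈ H
  · exact ⟨1, Z.one_mem, y, hy, by simp⟩
  -- `H` contains all squares, so it is normal and `H'`, its union with the coset of `y`, is a
  -- subgroup. By maximality of `H`, some `z ≠ 1` in `Z` has `z * y ∈ H`, and `y = z⁻¹ * (z * y)`.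
  let H' : Subgroup G :=
    { carrier := {g | g ∈ H ∨ g * y ∈ H}
      one_mem' := Or.inl H.one_mem
      mul_mem' := by
        rintro g g' (hg | hg) (hg' | hg')
        · exact Or.inl (H.mul_mem hg hg')
        · exact Or.inr (by rw [mul_assoc]; exact H.mul_mem hg hg')
        · refine Or.inr ?_
          have : g * g' * y = (g * y) * (y⁻¹ * g' * y⁻¹⁻¹) := by group
          rw [this]
          exact H.mul_mem hg (hconj _ hg' _)
        · refine Or.inl ?_
          have : g * g' = (g * y) * (y⁻¹ * (g' * y) * y⁻¹⁻¹) * (y⁻¹ * y⁻¹) := by group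
          rw [this]
          exact H.mul_mem (H.mul_mem hg (hconj _ hg' _)) (hsq _)
      inv_mem' := by
        rintro g (hg | hg)
        · exact Or.inl (H.inv_mem hg)
        · refine Or.inr ?_
          have : g⁻¹ * y = (y * (g * y)⁻¹ * y⁻¹) * (y * y) := by group
          rw [this]
          exact H.mul_mem (hconj _ (H.inv_mem hg) _) (hsq _) }
  have hle : H ≤ H' := fun x hx => Or.inl hx
  have hnot : H' ∉ P := fun hP => hy (hH.le_of_ge hP hle (Or.inr (hsq y)))
  have : ∃ z ∈ Z, z ∈ H' ∧ z ≠ 1 := by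
    by_contra! hcon
    exact hnot ⟨fun x => hle (hsq x), hcon⟩
  obtain ⟨z, hz, hz' | hz', hz1⟩ := this
  · exact absurd (hdisj z hz hz') hz1
  · exact ⟨z⁻¹, Z.inv_mem hz, z * y, hz', by group⟩

theorem exists_list_of_mem_closure_squares {z : G}
    (hz : z ∈ Subgroup.closure (Set.range fun y : G => y * y)) :
    ∃ l : List G, (l.map fun y => y * y).prod = z := by
  induction hz using Subgroup.closure_induction with
  | mem x hx => obtain ⟨y, rfl⟩ := hx; exact ⟨[y], by simp⟩
  | one => exact ⟨[], by simp⟩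
  | mul x y _ _ hx hy =>
    obtain ⟨l, rfl⟩ := hx
    obtain ⟨l', rfl⟩ := hy
    exact ⟨l ++ l', by simp⟩
  | inv x _ hx =>
    obtain ⟨l, rfl⟩ := hx
    refine ⟨(l.map fun y => y⁻¹).reverse, ?_⟩
    rw [List.prod_inv_reverse]
    simp [Function.comp_def, List.map_reverse]

end Groups

/-! ### Elementary equivalence and definable direct decompositions -/

namespace ElementarilyEquivalentGroups

theorem of_mulEquiv {G : Type*} {H : Type*} [Group G] [Group H] (e : G ≃* H) :
    ElementarilyEquivalentGroups G H := by
  let e' : G ≃[groupLanguage] H :=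
    { e.toEquiv with
      map_fun' := by
        intro n f x
        cases f
        · exact e.map_one
        · exact e.map_inv _
        · exact e.map_mul _ _
      map_rel' := by
        intro n r
        exact r.elim }
  exact StrongHomClass.elementarilyEquivalent e'

theorem trans {G : Type*} {H : Type*} {K : Type*} [Group G] [Group H] [Group K]
    (h : ElementarilyEquivalentGroups G H) (h' : ElementarilyEquivalentGroups H K) :
    ElementarilyEquivalentGroups G K := Eq.trans h h'

theorem of_forall {G : Type*} {H : Type*} [Group G] [Group H]
    (h : ∀ φ : groupLanguage.Sentence, H ⊨ φ → G ⊨ φ) : ElementarilyEquivalentGroups G H := by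
  refine elementarilyEquivalent_iff.2 fun φ => ⟨fun hG => ?_, h φ⟩
  by_contra hH
  exact (Sentence.realize_not G).1 (h φ.not ((Sentence.realize_not H).2 hH)) hG

end ElementarilyEquivalentGroups

namespace GroupFormula

variable {G : Type*} [Group G]

/-- The formula in variables `(a, b)` saying that the group is the internal direct product of the
centralizers of `a` and `b`. -/
noncomputable def isInternalProd (ι : Type*) [Finite ι] : groupLanguage.Formula (ι ⊕ ι) :=
  all (all ((centralizes (Term.var (Sum.inl (Sum.inr ())))
      fun i => Term.var (Sum.inl (Sum.inl (Sum.inl i)))).imp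
    ((centralizes (Term.var (Sum.inr ())) fun i => Term.var (Sum.inl (Sum.inl (Sum.inr i)))).imp
      ((mul (Term.var (Sum.inl (Sum.inr ()))) (Term.var (Sum.inr ()))).equal
        (mul (Term.var (Sum.inr ())) (Term.var (Sum.inl (Sum.inr ())))))))) ⊓
  (all ((centralizes (Term.var (Sum.inr ())) fun i => Term.var (Sum.inl (Sum.inl i))).imp
    ((centralizes (Term.var (Sum.inr ())) fun i => Term.var (Sum.inl (Sum.inr i))).imp
      ((Term.var (Sum.inr ())).equal one))) ⊓
  all (ex (ex ((centralizes (Term.var (Sum.inl (Sum.inr ())))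
      fun i => Term.var (Sum.inl (Sum.inl (Sum.inl (Sum.inl i))))) ⊓
    ((centralizes (Term.var (Sum.inr ()))
      fun i => Term.var (Sum.inl (Sum.inl (Sum.inl (Sum.inr i))))) ⊓
      ((Term.var (Sum.inl (Sum.inl (Sum.inr ())))).equal
        (mul (Term.var (Sum.inl (Sum.inr ()))) (Term.var (Sum.inr ())))))))))

theorem mem_centralizer_range {ι : Type*} {a : ι → G} {x : G} :
    x ∈ Subgroup.centralizer (Set.range a) ↔ ∀ i, x * a i = a i * x := by
  simp [Subgroup.mem_centralizer_iff, eq_comm]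

theorem realize_isInternalProd {ι : Type*} [Finite ι] (v : ι ⊕ ι → G) :
    (isInternalProd ι).Realize v ↔
      (Subgroup.centralizer (Set.range fun i => v (.inl i))).IsInternalProd
        (Subgroup.centralizer (Set.range fun i => v (.inr i))) := by
  simp only [isInternalProd, Formula.realize_inf, realize_all, realize_ex, Formula.realize_imp,
    realize_centralizes, Formula.realize_equal, realize_mul, realize_one, Term.realize_var,
    Sum.elim_inl, Sum.elim_inr, ← mem_centralizer_range]
  constructor
  · rintro ⟨h₁, h₂, h₃⟩
    exact ⟨fun c hc d hd => h₁ c d hc hd, h₂, fun g => by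
      obtain ⟨c, d, hc, hd, h⟩ := h₃ g
      exact ⟨c, hc, d, hd, h⟩⟩
  · rintro ⟨h₁, h₂, h₃⟩
    exact ⟨fun c d hc hd => h₁ c hc d hd, h₂, fun g => by
      obtain ⟨c, hc, d, hd, h⟩ := h₃ g
      exact ⟨c, d, hc, hd, h⟩⟩

/-- The formula in variables `(a, b, a', b')` saying that `a` and `a'` have the same centralizer,
and so do `b` and `b'`. -/
noncomputable def sameCentralizers (ι : Type*) [Finite ι] :
    groupLanguage.Formula ((ι ⊕ ι) ⊕ (ι ⊕ ι)) :=
  all (((centralizes (Term.var (Sum.inr ())) fun i => Term.var (Sum.inl (Sum.inl (Sum.inl i)))).iff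
      (centralizes (Term.var (Sum.inr ())) fun i => Term.var (Sum.inl (Sum.inr (Sum.inl i))))) ⊓
    ((centralizes (Term.var (Sum.inr ())) fun i => Term.var (Sum.inl (Sum.inl (Sum.inr i)))).iff
      (centralizes (Term.var (Sum.inr ())) fun i => Term.var (Sum.inl (Sum.inr (Sum.inr i))))))

theorem realize_sameCentralizers {ι : Type*} [Finite ι] (v w : ι ⊕ ι → G) :
    (sameCentralizers ι).Realize (Sum.elim v w) ↔
      Subgroup.centralizer (Set.range fun i => v (.inl i)) =
        Subgroup.centralizer (Set.range fun i => w (.inl i)) ∧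
      Subgroup.centralizer (Set.range fun i => v (.inr i)) =
        Subgroup.centralizer (Set.range fun i => w (.inr i)) := by
  simp only [sameCentralizers, Formula.realize_inf, realize_all, Formula.realize_iff,
    realize_centralizes, Term.realize_var, Sum.elim_inl, Sum.elim_inr, ← mem_centralizer_range,
    SetLike.ext_iff, forall_and]

/-- The formula in variables `(a, b, x)` saying that `x` centralizes `a`. -/
noncomputable def centralizesLeft (ι : Type*) [Finite ι] : groupLanguage.Formula ((ι ⊕ ι) ⊕ Unit) :=
  centralizes (Term.var (Sum.inr ())) fun i => Term.var (Sum.inl (Sum.inl i))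

/-- The formula in variables `(a, b, x)` saying that `x` centralizes `b`. -/
noncomputable def centralizesRight (ι : Type*) [Finite ι] :
    groupLanguage.Formula ((ι ⊕ ι) ⊕ Unit) :=
  centralizes (Term.var (Sum.inr ())) fun i => Term.var (Sum.inl (Sum.inr i))

theorem realize_centralizesLeft {ι : Type*} [Finite ι] (v : ι ⊕ ι → G) (x : G) :
    (centralizesLeft ι).Realize (Sum.elim v fun _ => x) ↔
      x ∈ Subgroup.centralizer (Set.range fun i => v (.inl i)) := by
  simp [centralizesLeft, mem_centralizer_range]

theorem realize_centralizesRight {ι : Type*} [Finite ι] (v : ι ⊕ ι → G) (x : G) :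
    (centralizesRight ι).Realize (Sum.elim v fun _ => x) ↔
      x ∈ Subgroup.centralizer (Set.range fun i => v (.inr i)) := by
  simp [centralizesRight, mem_centralizer_range]

end GroupFormula

open GroupFormula

/-- In a centreless internal direct product, the second factor is the centralizer of the first
components of a generating family. -/
theorem Subgroup.IsInternalProd.centralizer_components {G : Type*} [Group G] {C D : Subgroup G}
    (h : C.IsInternalProd D) (hZ : Subgroup.center G = ⊥) {ι : Type*} {a b : ι → G}
    (ha : ∀ i, a i ∈ C) (hb : ∀ i, b i ∈ D)
    (hgen : Subgroup.closure (Set.range fun i => a i * b i) = ⊤) :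
    Subgroup.centralizer (Set.range a) = D := by
  ext x
  rw [mem_centralizer_range]
  refine ⟨fun hx => ?_, fun hx i => (h.commute _ (ha i) x hx).symm⟩
  obtain ⟨c, hc, d, hd, rfl⟩ := h.exists_mul x
  have hca : ∀ i, c * a i = a i * c := fun i => by
    have h1 := hx i
    rw [mul_assoc, ← h.commute _ (ha i) d hd, ← mul_assoc, ← mul_assoc] at h1
    exact mul_right_cancel h1
  -- The element `c` commutes with every `a i` by the above and with every `b i` because it lies in
  -- `C`, so with all generators.
  have hcZ : c ∈ Subgroup.center G := by
    rw [← Subgroup.centralizer_univ, ← Subgroup.coe_top, ← hgen, Subgroup.centralizer_closure,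
      mem_centralizer_range]
    intro i
    rw [← mul_assoc, hca, mul_assoc, h.commute c hc _ (hb i), mul_assoc]
  rw [hZ, Subgroup.mem_bot] at hcZ
  rw [hcZ, one_mul]
  exact hd

/-- A group elementarily equivalent to a finitely generated centreless group with finitely many
internal direct decompositions decomposes accordingly. -/
theorem exists_isInternalProd_of_elementarilyEquivalent {G : Type*} {W : Type*} [Group G] [Group W]
    (h : ElementarilyEquivalentGroups G W) [hfg : Group.FG W] (hZ : Subgroup.center W = ⊥)
    (hfin : {p : Subgroup W × Subgroup W | p.1.IsInternalProd p.2}.Finite) {C D : Subgroup W}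
    [C.Normal] [D.Normal] (hCD : C.IsInternalProd D) :
    ∃ (K L : Subgroup G) (_ : K.Normal) (_ : L.Normal), K.IsInternalProd L ∧
      ElementarilyEquivalentGroups (G ⧸ K) (W ⧸ C) ∧
      ElementarilyEquivalentGroups (G ⧸ L) (W ⧸ D) := by
  obtain ⟨S, hS⟩ := Group.fg_iff.1 hfg
  have := hS.2.to_subtype
  choose c hc d hd hcd using hCD.exists_mul
  -- The sides are swapped: `C` is the centralizer of the `D`-components of the generators, and `D`
  -- that of the `C`-components.
  let t₀ : S ⊕ S → W := Sum.elim (fun s => d s) (fun s => c s)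
  have hcen₁ : Subgroup.centralizer (Set.range fun i => t₀ (.inl i)) = C := by
    refine hCD.symm.centralizer_components hZ (b := fun s : S => c s) (fun s => hd s)
      (fun s => hc s) ?_
    convert hS.1
    ext x
    constructor
    · rintro ⟨s, rfl⟩
      dsimp only [t₀, Sum.elim_inl]
      rw [← hCD.commute _ (hc s) _ (hd s), ← hcd]
      exact s.2
    · intro hx
      refine ⟨⟨x, hx⟩, ?_⟩
      dsimp only [t₀, Sum.elim_inl]
      rw [← hCD.commute _ (hc x) _ (hd x), ← hcd]
  have hcen₂ : Subgroup.centralizer (Set.range fun i => t₀ (.inr i)) = D := by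
    refine hCD.centralizer_components hZ (b := fun s : S => d s) (fun s => hc s)
      (fun s => hd s) ?_
    convert hS.1
    ext x
    constructor
    · rintro ⟨s, rfl⟩
      dsimp only [t₀, Sum.elim_inr]
      rw [← hcd]
      exact s.2
    · intro hx
      exact ⟨⟨x, hx⟩, (hcd x).symm⟩
  let cen : (S ⊕ S → W) → Subgroup W × Subgroup W := fun v =>
    (Subgroup.centralizer (Set.range fun i => v (.inl i)),
      Subgroup.centralizer (Set.range fun i => v (.inr i)))
  -- Parameters matter only through the pair of centralizers they define, and that pair is one of
  -- the finitely many decompositions of `W`.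
  let κ := {p // ∃ v, (isInternalProd S).Realize v ∧ cen v = p}
  have : Finite κ := by
    refine (hfin.subset ?_ : Set.Finite {p | ∃ v, (isInternalProd S).Realize v ∧ cen v = p})
    rintro _ ⟨v, hv, rfl⟩
    exact (realize_isInternalProd v).1 hv
  have key := exists_realization h (isInternalProd S) (sameCentralizers S)
    (fun j : κ => j.2.choose) (fun j => j.2.choose_spec.1) (fun x hx => by
      refine ⟨⟨cen x, x, hx, rfl⟩, ?_⟩
      rw [realize_sameCentralizers]
      have := (⟨cen x, x, hx, rfl⟩ : κ).2.choose_spec.2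
      exact ⟨(congrArg Prod.fst this).symm, (congrArg Prod.snd this).symm⟩)
    (b := t₀) (by rw [realize_isInternalProd, hcen₁, hcen₂]; exact hCD)
    ({ψ | ∃ φ : groupLanguage.Sentence, (W ⧸ C) ⊨ φ ∧ ψ = quotient (centralizesLeft S) φ} ∪
      {ψ | ∃ φ : groupLanguage.Sentence, (W ⧸ D) ⊨ φ ∧ ψ = quotient (centralizesRight S) φ})
    (by
      rintro _ (⟨φ, -, rfl⟩ | ⟨φ, -, rfl⟩) x y hx hy hxy h1
      · rw [realize_isInternalProd] at hx hy
        rw [realize_sameCentralizers] at hxy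
        have := hx.normal_left
        have h2 := (realize_quotient_sentence (realize_centralizesLeft x) φ).1 h1
        exact (realize_quotient_sentence (fun z => by
          rw [realize_centralizesLeft, hxy.1]) φ).2 h2
      · rw [realize_isInternalProd] at hx hy
        rw [realize_sameCentralizers] at hxy
        have := hx.normal_right
        have h2 := (realize_quotient_sentence (realize_centralizesRight x) φ).1 h1
        exact (realize_quotient_sentence (fun z => by
          rw [realize_centralizesRight, hxy.2]) φ).2 h2)
    (by
      rintro _ (⟨φ, h1, rfl⟩ | ⟨φ, h1, rfl⟩)
      · exact (realize_quotient_sentence (fun z => by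
          rw [realize_centralizesLeft, hcen₁]) φ).2 h1
      · exact (realize_quotient_sentence (fun z => by
          rw [realize_centralizesRight, hcen₂]) φ).2 h1)
  obtain ⟨a, ha, hψ⟩ := key
  rw [realize_isInternalProd] at ha
  have hK := ha.normal_left
  have hL := ha.normal_right
  refine ⟨_, _, hK, hL, ha, ?_, ?_⟩
  · refine (ElementarilyEquivalentGroups.of_forall fun φ h1 => ?_)
    exact (realize_quotient_sentence (realize_centralizesLeft a) φ).1
      (hψ _ (Or.inl ⟨φ, h1, rfl⟩))
  · refine (ElementarilyEquivalentGroups.of_forall fun φ h1 => ?_)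
    exact (realize_quotient_sentence (realize_centralizesRight a) φ).1
      (hψ _ (Or.inr ⟨φ, h1, rfl⟩))

/-! ### Splitting off the finite factor -/

namespace GroupFormula

variable {G : Type*} [Group G]

/-- The formula in variables indexed by a finite group `F` saying that the variables form the image
of an embedding of `F` which together with its centralizer generates the group. -/
noncomputable def isCentralEmbedding (F : Type*) [Group F] [Finite F] : groupLanguage.Formula F :=
  (Formula.iInf fun p : F × F =>
    (Term.var (p.1 * p.2)).equal (mul (Term.var p.1) (Term.var p.2))) ⊓
  ((Formula.iInf fun p : {p : F × F // p.1 ≠ p.2} =>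
    ((Term.var p.1.1 : groupLanguage.Term F).equal (Term.var p.1.2)).not) ⊓
  all (ex ((centralizes (Term.var (Sum.inr ())) fun f => Term.var (Sum.inl (Sum.inl f))) ⊓
    (Formula.iSup fun f => (Term.var (Sum.inl (Sum.inr ()))).equal
      (mul (Term.var (Sum.inl (Sum.inl f))) (Term.var (Sum.inr ())))))))

theorem realize_isCentralEmbedding {F : Type*} [Group F] [Finite F] (x : F → G) :
    (isCentralEmbedding F).Realize x ↔ (∀ f g, x (f * g) = x f * x g) ∧ Function.Injective x ∧
      ∀ g, ∃ h, (∀ f, h * x f = x f * h) ∧ ∃ f, g = x f * h := by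
  simp only [isCentralEmbedding, Formula.realize_inf, Formula.realize_iInf, Formula.realize_equal,
    Formula.realize_not, realize_all, realize_ex, realize_centralizes, Formula.realize_iSup,
    realize_mul, Term.realize_var, Sum.elim_inl, Sum.elim_inr, Prod.forall, Subtype.forall]
  refine and_congr_right fun _ => and_congr_left fun _ => ?_
  exact ⟨fun h f g hfg => by_contra fun hne => h f g hne hfg, fun h f g hne hfg => hne (h hfg)⟩

/-- The formula saying that two tuples are equal. -/
noncomputable def tupleEq (α : Type*) [Finite α] : groupLanguage.Formula (α ⊕ α) :=
  Formula.iInf fun a => (Term.var (Sum.inl a)).equal (Term.var (Sum.inr a))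

theorem realize_tupleEq {α : Type*} [Finite α] (x y : α → G) :
    (tupleEq α).Realize (Sum.elim x y) ↔ x = y := by
  simp [tupleEq, funext_iff]

/-- The formula saying that the last variable is one of the others. -/
noncomputable def memRange (α : Type*) [Finite α] : groupLanguage.Formula (α ⊕ Unit) :=
  Formula.iSup fun a => (Term.var (Sum.inl a)).equal (Term.var (Sum.inr ()))

theorem realize_memRange {α : Type*} [Finite α] (x : α → G) (y : G) :
    (memRange α).Realize (Sum.elim x fun _ => y) ↔ y ∈ Set.range x := by
  simp [memRange]

/-- The formula saying that a product of `n` squares of elements centralizing the variables is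
trivial as soon as it is one of the variables. -/
noncomputable def squaresDisjoint (α : Type*) [Finite α] (n : ℕ) : groupLanguage.Formula α :=
  Formula.iAlls (Fin n) ((Formula.iInf fun i : Fin n =>
      centralizes (Term.var (Sum.inr i)) fun a : α => Term.var (Sum.inl a)).imp
    (Formula.iInf fun a : α =>
      ((prodSq (List.ofFn fun i : Fin n => Term.var (Sum.inr i))).equal
        (Term.var (Sum.inl a))).imp ((Term.var (Sum.inl a)).equal one)))

theorem realize_squaresDisjoint {α : Type*} [Finite α] {n : ℕ} (x : α → G) :
    (squaresDisjoint α n).Realize x ↔ ∀ y : Fin n → G, (∀ i a, y i * x a = x a * y i) →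
      ∀ a, (List.ofFn fun i => y i * y i).prod = x a → x a = 1 := by
  simp [squaresDisjoint, List.map_ofFn, Function.comp_def]

theorem exists_hom_of_realize_isCentralEmbedding {F : Type*} [Group F] [Finite F] {x : F → G}
    (hx : (isCentralEmbedding F).Realize x) :
    ∃ φ : F →* G, ⇑φ = x ∧ Function.Injective φ ∧ φ.range.Normal ∧
      ∀ g, ∃ k ∈ φ.range, ∃ h ∈ Subgroup.centralizer (φ.range : Set G), g = k * h := by
  obtain ⟨hmul, hinj, hgen⟩ := (realize_isCentralEmbedding x).1 hx
  let φ : F →* G := MonoidHom.mk' x hmul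
  have hgen' : ∀ g, ∃ k ∈ φ.range, ∃ h ∈ Subgroup.centralizer (φ.range : Set G), g = k * h := by
    intro g
    obtain ⟨h, hh, f, rfl⟩ := hgen g
    refine ⟨x f, ⟨f, rfl⟩, h, Subgroup.mem_centralizer_iff.2 ?_, rfl⟩
    rintro _ ⟨f', rfl⟩
    exact (hh f').symm
  refine ⟨φ, rfl, hinj, ⟨fun k hk g => ?_⟩, hgen'⟩
  obtain ⟨k', hk', h, hh, rfl⟩ := hgen' g
  have : k' * h * k * (k' * h)⁻¹ = k' * k * k'⁻¹ := by
    rw [mul_assoc k' h k, ← Subgroup.mem_centralizer_iff.1 hh k hk]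
    group
  rw [this]
  exact φ.range.mul_mem (φ.range.mul_mem hk' hk) (φ.range.inv_mem hk')

end GroupFormula


/-- A finite normal subgroup `K` of `G` with `G = K C(K)` is a direct factor if products of squares
of elements of its centralizer meet it trivially. -/
theorem Subgroup.exists_isInternalProd_of_squares {G : Type*} [Group G] (K : Subgroup G)
    (hK : ∀ g, ∃ k ∈ K, ∃ h ∈ Subgroup.centralizer (K : Set G), g = k * h)
    (hsq : ∀ l : List G, (∀ y ∈ l, y ∈ Subgroup.centralizer (K : Set G)) →
      (l.map fun y => y * y).prod ∈ K → (l.map fun y => y * y).prod = 1) :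
    ∃ H : Subgroup G, K.IsInternalProd H := by
  let A := Subgroup.centralizer (K : Set G)
  -- As `G` is `K` times its centralizer, a complement of the centre of `K` inside the centralizer
  -- is a complement of `K` in `G`.
  obtain ⟨H, hdisj, hmul⟩ := exists_complement_of_disjoint_squares (K.comap A.subtype) (by
    intro z hz hz'
    obtain ⟨l, hl⟩ := exists_list_of_mem_closure_squares hz'
    have h1 : ((l.map Subtype.val).map fun y => y * y).prod = (z : G) := by
      rw [← hl, ← A.coe_subtype, map_list_prod, List.map_map, List.map_map]
      rfl
    refine Subtype.ext ?_
    rw [← h1]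
    refine hsq _ (fun y hy => ?_) (by rw [h1]; exact hz)
    obtain ⟨y, -, rfl⟩ := List.mem_map.1 hy
    exact y.2)
  refine ⟨H.map A.subtype, ⟨?_, ?_, ?_⟩⟩
  · rintro c hc _ ⟨d, -, rfl⟩
    exact Subgroup.mem_centralizer_iff.1 d.2 c hc
  · rintro _ hx ⟨x, hxH, rfl⟩
    exact congrArg Subtype.val (hdisj x hx hxH)
  · intro g
    obtain ⟨k, hk, a, ha, rfl⟩ := hK g
    obtain ⟨z, hz, h, hh, hzh⟩ := hmul ⟨a, ha⟩
    refine ⟨k * z, K.mul_mem hk hz, h, ⟨h, hh, rfl⟩, ?_⟩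
    rw [mul_assoc, ← Subgroup.coe_mul, ← hzh]

/-- Let `W` be the internal direct product of its largest finite normal subgroup `F`, whose centre
has exponent two, and of `D`. Then every group elementarily equivalent to `W` splits off a copy of
`F`, with a quotient elementarily equivalent to `W ⧸ F`. -/
theorem exists_finite_factor_of_elementarilyEquivalent {G : Type*} {W : Type*} [Group G] [Group W]
    (h : ElementarilyEquivalentGroups G W) {F D : Subgroup W} [Finite F] [F.Normal]
    (hFD : F.IsInternalProd D)
    (hmax : ∀ N : Subgroup W, N.Normal → Finite N → N ≤ F)
    (hF : ∀ z ∈ F, (∀ f ∈ F, z * f = f * z) → z * z = 1) :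
    ∃ (K H : Subgroup G) (_ : K.Normal), K.IsInternalProd H ∧ Nonempty (F ≃* K) ∧
      ElementarilyEquivalentGroups (G ⧸ K) (W ⧸ F) := by
  have hb : (isCentralEmbedding F).Realize (fun f : F => (f : W)) := by
    rw [realize_isCentralEmbedding]
    refine ⟨fun _ _ => rfl, Subtype.val_injective, fun g => ?_⟩
    obtain ⟨c, hc, d, hd, rfl⟩ := hFD.exists_mul g
    exact ⟨d, fun f => (hFD.commute f f.2 d hd).symm, ⟨c, hc⟩, rfl⟩
  let κ := {x : F → W // (isCentralEmbedding F).Realize x}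
  -- The image of such an embedding is a finite normal subgroup, hence inside `F`; so only finitely
  -- many tuples qualify.
  have hκ : ∀ (x : κ) f, x.1 f ∈ F := by
    intro x f
    obtain ⟨φ, hφ, -, hn, -⟩ := exists_hom_of_realize_isCentralEmbedding x.2
    rw [← hφ]
    exact hmax _ hn (Set.finite_range φ).to_subtype ⟨f, rfl⟩
  have : Finite κ := Finite.of_injective (fun (x : κ) (f : F) => (⟨x.1 f, hκ x f⟩ : F))
    fun x y hxy => Subtype.ext (funext fun f => congrArg Subtype.val (congrFun hxy f))
  have hsqW : ∀ n, (squaresDisjoint F n).Realize (fun f : F => (f : W)) := by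
    intro n
    rw [realize_squaresDisjoint]
    intro y hy a ha
    refine hFD.disjoint _ a.2 (ha ▸ D.list_prod_mem fun z hz => ?_)
    obtain ⟨i, rfl⟩ := List.mem_ofFn.1 hz
    -- Centralizing `F` forces the `F`-part `c` into the centre of `F`, where squares are trivial;
    -- the square of `y i` is then that of `d`.
    obtain ⟨c, hc, d, hd, hcd⟩ := hFD.exists_mul (y i)
    have hc2 : c * c = 1 := hF c hc fun f hf => by
      have h1 := hy i ⟨f, hf⟩
      rw [hcd, mul_assoc, ← hFD.commute f hf d hd, ← mul_assoc, ← mul_assoc] at h1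
      exact mul_right_cancel h1
    have : y i * y i = d * d := by
      rw [hcd, mul_assoc, ← mul_assoc d, ← hFD.commute c hc d hd, mul_assoc c d, ← mul_assoc c c,
        hc2, one_mul]
    rw [this]
    exact D.mul_mem hd hd
  have hrange : Set.range (fun f : F => (f : W)) = F := Subtype.range_coe
  obtain ⟨x, hx, hψ⟩ := exists_realization h (isCentralEmbedding F) (tupleEq F)
    (fun j : κ => j.1) (fun j => j.2)
    (fun x hx => ⟨⟨x, hx⟩, (realize_tupleEq _ _).2 rfl⟩) hb
    ({ψ | ∃ φ : groupLanguage.Sentence, (W ⧸ F) ⊨ φ ∧ ψ = quotient (memRange F) φ} ∪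
      Set.range (squaresDisjoint F))
    (by
      rintro ψ - x y - - hxy h1
      rwa [← (realize_tupleEq x y).1 hxy])
    (by
      rintro _ (⟨φ, h1, rfl⟩ | ⟨n, rfl⟩)
      · exact (realize_quotient_sentence (fun z => by
          rw [realize_memRange, hrange, SetLike.mem_coe]) φ).2 h1
      · exact hsqW n)
  obtain ⟨φ, rfl, hinj, hn, hmul⟩ := exists_hom_of_realize_isCentralEmbedding hx
  obtain ⟨H, hH⟩ := φ.range.exists_isInternalProd_of_squares hmul (by
    rintro l hl ⟨f, hf⟩
    have h1 := (realize_squaresDisjoint (n := l.length) φ).1 (hψ _ (Or.inr ⟨_, rfl⟩))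
      (fun i => l.get i) (fun i a => by
        exact (Subgroup.mem_centralizer_iff.1 (hl _ (l.get_mem i)) _ ⟨a, rfl⟩).symm) f
    have h2 : List.ofFn (fun i => l.get i * l.get i) = l.map fun y => y * y := by
      conv_rhs => rw [← List.ofFn_get l, List.map_ofFn]
      rfl
    rw [h2, hf] at h1
    exact h1 rfl)
  refine ⟨φ.range, H, hn, hH, ⟨φ.ofInjective hinj⟩,
    ElementarilyEquivalentGroups.of_forall fun χ hχ => ?_⟩
  exact (realize_quotient_sentence (fun z => by
    rw [realize_memRange, MonoidHom.mem_range, Set.mem_range]) χ).1 (hψ _ (Or.inl ⟨χ, hχ, rfl⟩))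

/-! ### Direct decompositions of a product of centreless groups -/

section Decompositions

variable {A B : Type*} [Group A] [Group B]

/-- The commutation relation puts `(c' * c)⁻¹ * (c * c')`, an element of `C`, into `D` as well. -/
theorem Subgroup.IsInternalProd.commute_of_commute {G : Type*} [Group G] {C D : Subgroup G}
    (h : C.IsInternalProd D) {c c' d d' : G} (hc : c ∈ C) (hc' : c' ∈ C) (hd : d ∈ D) (hd' : d' ∈ D)
    (hcomm : c * d * (c' * d') = c' * d' * (c * d)) : c * c' = c' * c := by
  have h1 : (c' * c)⁻¹ * (c * c') = d' * d * (d * d')⁻¹ := by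
    rw [inv_mul_eq_iff_eq_mul, ← mul_assoc, eq_mul_inv_iff_mul_eq]
    calc c * c' * (d * d') = c * (c' * d) * d' := by group
      _ = c * d * (c' * d') := by rw [h.commute c' hc' d hd]; group
      _ = c' * (d' * c) * d := by rw [hcomm]; group
      _ = c' * c * (d' * d) := by rw [← h.commute c hc d' hd']; group
  have h2 := h.disjoint _ (C.mul_mem (C.inv_mem (C.mul_mem hc' hc)) (C.mul_mem hc hc'))
    (h1 ▸ D.mul_mem (D.mul_mem hd' hd) (D.inv_mem (D.mul_mem hd hd')))
  exact (inv_mul_eq_one.1 h2).symm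

/-- The `C`-part `c` of `(a, 1)` commutes with every `(1, b)`: with its `C`-part because `(a, 1)`
and `(1, b)` commute, with its `D`-part trivially. So the second coordinate of `c` is central in
`B`. -/
theorem Subgroup.IsInternalProd.exists_mul_inl (hB : Subgroup.center B = ⊥)
    {C D : Subgroup (A × B)} (h : C.IsInternalProd D) (a : A) :
    ∃ x y : A, (x, 1) ∈ C ∧ (y, 1) ∈ D ∧ a = x * y := by
  obtain ⟨c, hc, d, hd, hcd⟩ := h.exists_mul (a, 1)
  have hc2 : c.2 ∈ Subgroup.center B := by
    rw [Subgroup.mem_center_iff]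
    intro b
    obtain ⟨c', hc', d', hd', hcd'⟩ := h.exists_mul (1, b)
    have h1 : c * c' = c' * c := h.commute_of_commute hc hc' hd hd' (by
      rw [← hcd, ← hcd']; simp)
    have h2 : c * (1, b) = (1, b) * c := by
      rw [hcd', ← mul_assoc, h1, mul_assoc, h.commute c hc d' hd', mul_assoc]
    exact (congrArg Prod.snd h2).symm
  rw [hB, Subgroup.mem_bot] at hc2
  have hd2 : d.2 = 1 := by
    have := congrArg Prod.snd hcd
    simpa [hc2] using this.symm
  exact ⟨c.1, d.1, by rwa [← hc2], by rwa [← hd2], congrArg Prod.fst hcd⟩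

theorem Subgroup.IsInternalProd.map_equiv {G H : Type*} [Group G] [Group H] {C D : Subgroup G}
    (h : C.IsInternalProd D) (e : H ≃* G) :
    (C.comap e.toMonoidHom).IsInternalProd (D.comap e.toMonoidHom) where
  commute c hc d hd := e.injective (by simpa using h.commute _ hc _ hd)
  disjoint x hx hx' := e.injective (by simpa using h.disjoint _ hx hx')
  exists_mul g := by
    obtain ⟨c, hc, d, hd, hcd⟩ := h.exists_mul (e g)
    exact ⟨e.symm c, by simpa using hc, e.symm d, by simpa using hd, e.injective (by simpa using hcd)⟩

theorem Subgroup.IsInternalProd.exists_mul_inr (hA : Subgroup.center A = ⊥)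
    {C D : Subgroup (A × B)} (h : C.IsInternalProd D) (b : B) :
    ∃ x y : B, (1, x) ∈ C ∧ (1, y) ∈ D ∧ b = x * y :=
  (h.map_equiv (MulEquiv.prodComm (M := B) (N := A))).exists_mul_inl hA b

theorem Subgroup.IsInternalProd.comap_inl (hB : Subgroup.center B = ⊥)
    {C D : Subgroup (A × B)} (h : C.IsInternalProd D) :
    (C.comap (MonoidHom.inl A B)).IsInternalProd (D.comap (MonoidHom.inl A B)) where
  commute c hc d hd := congrArg Prod.fst (h.commute _ hc _ hd)
  disjoint x hx hx' := congrArg Prod.fst (h.disjoint _ hx hx')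
  exists_mul a := by
    obtain ⟨x, y, hx, hy, rfl⟩ := h.exists_mul_inl hB a
    exact ⟨x, hx, y, hy, rfl⟩

theorem Subgroup.IsInternalProd.comap_inr (hA : Subgroup.center A = ⊥)
    {C D : Subgroup (A × B)} (h : C.IsInternalProd D) :
    (C.comap (MonoidHom.inr A B)).IsInternalProd (D.comap (MonoidHom.inr A B)) where
  commute c hc d hd := congrArg Prod.snd (h.commute _ hc _ hd)
  disjoint x hx hx' := congrArg Prod.snd (h.disjoint _ hx hx')
  exists_mul a := by
    obtain ⟨x, y, hx, hy, rfl⟩ := h.exists_mul_inr hA a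
    exact ⟨x, hx, y, hy, rfl⟩

/-- In a centreless product, the left factor of a direct decomposition is itself a product. -/
theorem Subgroup.IsInternalProd.mem_left_iff (hA : Subgroup.center A = ⊥)
    (hB : Subgroup.center B = ⊥) {C D : Subgroup (A × B)} (h : C.IsInternalProd D) (z : A × B) :
    z ∈ C ↔ (z.1, 1) ∈ C ∧ (1, z.2) ∈ C := by
  refine ⟨fun hz => ?_, fun hz => by simpa using C.mul_mem hz.1 hz.2⟩
  obtain ⟨a, b⟩ := z
  obtain ⟨x, y, hx, hy, rfl⟩ := h.exists_mul_inl hB a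
  obtain ⟨x', y', hx', hy', rfl⟩ := h.exists_mul_inr hA b
  have h1 : ((y, y') : A × B) = 1 := by
    refine h.disjoint _ ?_ (by simpa using D.mul_mem hy hy')
    have : ((y, y') : A × B) = (x, x')⁻¹ * (x * y, x' * y') := by simp
    rw [this]
    exact C.mul_mem (C.inv_mem (by simpa using C.mul_mem hx hx')) hz
  obtain ⟨rfl, rfl⟩ := Prod.mk_eq_one.1 h1
  simpa using ⟨hx, hx'⟩

/-- A decomposition is determined by its traces on the two factors, which are themselves
decompositions. -/
theorem finite_isInternalProd_prod (hA : Subgroup.center A = ⊥) (hB : Subgroup.center B = ⊥)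
    (hfA : {p : Subgroup A × Subgroup A | p.1.IsInternalProd p.2}.Finite)
    (hfB : {p : Subgroup B × Subgroup B | p.1.IsInternalProd p.2}.Finite) :
    {p : Subgroup (A × B) × Subgroup (A × B) | p.1.IsInternalProd p.2}.Finite := by
  refine Set.Finite.of_finite_image (f := fun p =>
    ((p.1.comap (MonoidHom.inl A B), p.2.comap (MonoidHom.inl A B)),
      (p.1.comap (MonoidHom.inr A B), p.2.comap (MonoidHom.inr A B))))
    ((hfA.prod hfB).subset ?_) ?_
  · rintro _ ⟨p, hp, rfl⟩
    exact ⟨hp.comap_inl hB, hp.comap_inr hA⟩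
  · rintro p hp q hq hpq
    simp only [Prod.mk.injEq, SetLike.ext_iff, Subgroup.mem_comap, MonoidHom.inl_apply,
      MonoidHom.inr_apply] at hpq
    obtain ⟨⟨h1, h2⟩, h3, h4⟩ := hpq
    refine Prod.ext ?_ ?_
    · ext z
      rw [hp.mem_left_iff hA hB, hq.mem_left_iff hA hB, h1, h3]
    · ext z
      rw [hp.symm.mem_left_iff hA hB, hq.symm.mem_left_iff hA hB, h2, h4]

theorem isInternalProd_ker_snd_ker_fst :
    (MonoidHom.snd A B).ker.IsInternalProd (MonoidHom.fst A B).ker where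
  commute := by
    rintro ⟨a, b⟩ hc ⟨a', b'⟩ hd
    obtain rfl : b = 1 := hc
    obtain rfl : a' = 1 := hd
    simp
  disjoint := by
    rintro ⟨a, b⟩ hc hd
    obtain rfl : b = 1 := hc
    obtain rfl : a = 1 := hd
    rfl
  exists_mul := fun ⟨a, b⟩ => ⟨(a, 1), rfl, (1, b), rfl, by simp⟩

theorem nonempty_quotient_ker_snd : Nonempty ((A × B) ⧸ (MonoidHom.snd A B).ker ≃* B) :=
  ⟨QuotientGroup.quotientKerEquivOfSurjective _ Prod.snd_surjective⟩

theorem nonempty_quotient_ker_fst : Nonempty ((A × B) ⧸ (MonoidHom.fst A B).ker ≃* A) :=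
  ⟨QuotientGroup.quotientKerEquivOfSurjective _ Prod.fst_surjective⟩

end Decompositions

/-! ### Rigid factors and the reduction to infinite irreducible groups -/

theorem FinitelyTorsionGenerated.of_surjective {G : Type*} {H : Type*} [Group G] [Group H]
    (h : FinitelyTorsionGenerated G) (f : G →* H) (hf : Function.Surjective f) :
    FinitelyTorsionGenerated H := by
  classical
  obtain ⟨T, hT, hgen⟩ := h
  refine ⟨T.image f, fun g hg => ?_, ?_⟩
  · obtain ⟨x, hx, rfl⟩ := Finset.mem_image.1 hg
    exact f.isOfFinOrder (hT x hx)
  · rw [Finset.coe_image, ← MonoidHom.map_closure, hgen, ← MonoidHom.range_eq_map,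
      MonoidHom.range_eq_top.2 hf]

theorem TorsionGeneratedModelsAreCoxeter.of_mulEquiv {W W' : Type u} [Group W] [Group W']
    (h : TorsionGeneratedModelsAreCoxeter.{u, v} W) (e : W ≃* W') :
    TorsionGeneratedModelsAreCoxeter.{u, v} W' := fun G _ hG hGW =>
  h G hG (hGW.trans (.of_mulEquiv e.symm))

/-- The properties of an infinite irreducible Coxeter group that are used, in a form stable under
direct products. -/
structure IsRigidFactor (W : Type u) [Group W] : Prop where
  fg : Group.FG W
  center : Subgroup.center W = ⊥
  finite_normal : ∀ N : Subgroup W, N.Normal → Finite N → N = ⊥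
  finite_decompositions : {p : Subgroup W × Subgroup W | p.1.IsInternalProd p.2}.Finite
  models : TorsionGeneratedModelsAreCoxeter.{u, v} W

namespace IsRigidFactor

theorem of_subsingleton (W : Type u) [Group W] [Subsingleton W] : IsRigidFactor.{u, v} W where
  fg := inferInstance
  center := Subsingleton.elim _ _
  finite_normal _ _ _ := Subsingleton.elim _ _
  finite_decompositions := Set.toFinite _
  models G _ _ hGW := by
    let φ : groupLanguage.Sentence := all ((Term.var (Sum.inr ())).equal one)
    have hφ : G ⊨ φ := (elementarilyEquivalent_iff.1 hGW φ).2 (realize_all.2 fun x => by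
      simpa using Subsingleton.elim _ _)
    have : Subsingleton G := by
      have h1 : ∀ x : G, x = 1 := fun x => by simpa using realize_all.1 hφ x
      exact ⟨fun x y => (h1 x).trans (h1 y).symm⟩
    exact .of_subsingleton G

theorem prod {A B : Type u} [Group A] [Group B] (hA : IsRigidFactor.{u, v} A)
    (hB : IsRigidFactor.{u, v} B) : IsRigidFactor.{u, v} (A × B) := by
  have := hA.fg
  have := hB.fg
  have hZ : Subgroup.center (A × B) = ⊥ := by
    rw [Subgroup.eq_bot_iff_forall]
    rintro ⟨a, b⟩ h
    rw [Subgroup.mem_center_iff] at h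
    have ha : a ∈ Subgroup.center A := Subgroup.mem_center_iff.2 fun g =>
      congrArg Prod.fst (h (g, 1))
    have hb : b ∈ Subgroup.center B := Subgroup.mem_center_iff.2 fun g =>
      congrArg Prod.snd (h (1, g))
    rw [hA.center, Subgroup.mem_bot] at ha
    rw [hB.center, Subgroup.mem_bot] at hb
    rw [ha, hb]
    rfl
  have hfin := finite_isInternalProd_prod hA.center hB.center hA.finite_decompositions
    hB.finite_decompositions
  have hfg : Group.FG (A × B) := inferInstance
  refine ⟨hfg, hZ, fun N hN hNf => ?_, hfin, fun G _ hG hGW => ?_⟩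
  · have h1 := hA.finite_normal (N.map (MonoidHom.fst A B)) (hN.map _ Prod.fst_surjective)
      (Set.Finite.image _ (Set.toFinite (N : Set (A × B)))).to_subtype
    have h2 := hB.finite_normal (N.map (MonoidHom.snd A B)) (hN.map _ Prod.snd_surjective)
      (Set.Finite.image _ (Set.toFinite (N : Set (A × B)))).to_subtype
    rw [Subgroup.eq_bot_iff_forall] at h1 h2 ⊢
    exact fun x hx => Prod.ext (h1 _ ⟨x, hx, rfl⟩) (h2 _ ⟨x, hx, rfl⟩)
  · obtain ⟨K, L, hK, hL, hKL, hGK, hGL⟩ := exists_isInternalProd_of_elementarilyEquivalent hGW hZ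
      hfin (isInternalProd_ker_snd_ker_fst (A := A) (B := B))
    obtain ⟨e⟩ := hKL.nonempty_mulEquiv_quotient_prod
    obtain ⟨eA⟩ := nonempty_quotient_ker_fst (A := A) (B := B)
    obtain ⟨eB⟩ := nonempty_quotient_ker_snd (A := A) (B := B)
    have h1 := hB.models (G ⧸ K) (hG.of_surjective _ (QuotientGroup.mk'_surjective K))
      (hGK.trans (.of_mulEquiv eB))
    have h2 := hA.models (G ⧸ L) (hG.of_surjective _ (QuotientGroup.mk'_surjective L))
      (hGL.trans (.of_mulEquiv eA))
    exact (h1.prod h2).of_mulEquiv e.symm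

theorem of_connected {n : ℕ} {M : CoxeterMatrix (Fin n)} {W : Type u} [Group W] [Infinite W]
    (cs : CoxeterSystem M W) (hM : (coxeterDiagram M).Connected)
    (h : TorsionGeneratedModelsAreCoxeter.{u, v} W) : IsRigidFactor.{u, v} W where
  fg := Group.fg_iff.2 ⟨_, cs.subgroup_closure_range_simple, Set.finite_range _⟩
  center := cs.center_eq_bot hM
  finite_normal _ _ _ := cs.eq_bot_of_finite_normal hM _
  finite_decompositions := by
    refine (Set.toFinite {(⊥, ⊤), (⊤, ⊥)}).subset ?_
    rintro ⟨C, D⟩ (hCD : C.IsInternalProd D)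
    have aux : ∀ {C D : Subgroup W}, C.IsInternalProd D → C = ⊥ → D = ⊤ := by
      rintro C D h rfl
      refine (Subgroup.eq_top_iff' _).2 fun g => ?_
      obtain ⟨c, hc, d, hd, rfl⟩ := h.exists_mul g
      rw [Subgroup.mem_bot.1 hc, one_mul]
      exact hd
    rcases cs.eq_bot_or_eq_bot_of_isInternalProd hM (cs.center_eq_bot hM) hCD with h | h
    · exact Or.inl (Prod.ext h (aux hCD h))
    · exact Or.inr (Prod.ext (aux hCD.symm h) h)
  models := h

end IsRigidFactor

/-- An infinite Coxeter group with connected diagram is directly indecomposable. -/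
theorem CoxeterSystem.directlyIndecomposable {B : Type*} [Finite B] {M : CoxeterMatrix B}
    {W : Type u} [Group W] [Infinite W] (cs : CoxeterSystem M W)
    (hM : (coxeterDiagram M).Connected) : DirectlyIndecomposable W := by
  refine ⟨inferInstance, fun A B _ _ ⟨e⟩ => ?_⟩
  have h := (isInternalProd_ker_snd_ker_fst (A := A) (B := B)).map_equiv e
  refine (cs.eq_bot_or_eq_bot_of_isInternalProd hM (cs.center_eq_bot hM) h).imp ?_ ?_
  · intro h1
    have h2 : ∀ a : A, a = 1 := fun a => by
      have := (Subgroup.eq_bot_iff_forall _).1 h1 (e.symm (a, 1)) (by simp [Subgroup.mem_prod])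
      simpa using this
    exact ⟨fun x y => (h2 x).trans (h2 y).symm⟩
  · intro h1
    have h2 : ∀ a : B, a = 1 := fun a => by
      have := (Subgroup.eq_bot_iff_forall _).1 h1 (e.symm (1, a)) (by simp [Subgroup.mem_prod])
      simpa using this
    exact ⟨fun x y => (h2 x).trans (h2 y).symm⟩

/-- A finite normal subgroup of `F × W` projects trivially to `W`, so `F` is the largest one; its
centre has exponent two, so every model splits off a copy of `F`. -/
theorem TorsionGeneratedModelsAreCoxeter.finite_prod {F W : Type u} [Group F] [Group W] [Finite F]
    (hF : IsFinRankCoxeterGroup F) (hW : IsRigidFactor.{u, v} W) :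
    TorsionGeneratedModelsAreCoxeter.{u, v} (F × W) := by
  intro G _ hG hGW
  obtain ⟨n, M, ⟨cs⟩⟩ := id hF
  have hprod := isInternalProd_ker_snd_ker_fst (A := F) (B := W)
  obtain ⟨e₁⟩ := hprod.nonempty_mulEquiv_quotient
  obtain ⟨e₂⟩ := nonempty_quotient_ker_fst (A := F) (B := W)
  obtain ⟨e₃⟩ := nonempty_quotient_ker_snd (A := F) (B := W)
  have hfin : Finite (MonoidHom.snd F W).ker := Finite.of_equiv F (e₁.trans e₂).symm.toEquiv
  obtain ⟨K, H, hK, hKH, ⟨e₄⟩, hGK⟩ := exists_finite_factor_of_elementarilyEquivalent hGW hprod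
    (fun N hN hNf x hx => by
      have h2 := hW.finite_normal (N.map (MonoidHom.snd F W)) (hN.map _ Prod.snd_surjective)
        (Set.Finite.image _ (Set.toFinite (N : Set (F × W)))).to_subtype
      exact (Subgroup.eq_bot_iff_forall _).1 h2 _ ⟨x, hx, rfl⟩)
    (by
      rintro ⟨f, w⟩ hz hcomm
      obtain rfl : w = 1 := hz
      have hf : f ∈ Subgroup.center F := Subgroup.mem_center_iff.2 fun g =>
        (congrArg Prod.fst (hcomm (g, 1) rfl)).symm
      exact Prod.ext (cs.mul_self_eq_one_of_mem_center hf) (mul_one 1))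
  have hH := hKH.normal_right
  obtain ⟨e₅⟩ := hKH.nonempty_mulEquiv_quotient
  obtain ⟨e₆⟩ := hKH.nonempty_mulEquiv_quotient_prod
  have h1 := hW.models (G ⧸ K) (hG.of_surjective _ (QuotientGroup.mk'_surjective K))
    (hGK.trans (.of_mulEquiv e₃))
  have h2 : IsFinRankCoxeterGroup (G ⧸ H) :=
    hF.of_mulEquiv ((e₁.trans e₂).symm.trans (e₄.trans e₅))
  exact (h1.prod h2).of_mulEquiv e₆.symm

/-- Every Coxeter group is the product of a finite Coxeter group and a rigid factor, if the
assertion holds for the infinite Coxeter groups with connected diagram. -/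
theorem CoxeterSystem.exists_finite_prod_rigidFactor
    (h : ∀ (W : Type u) [Group W], Infinite W → IsConnectedCoxeterGroup W →
      TorsionGeneratedModelsAreCoxeter.{u, v} W) {n : ℕ} {M : CoxeterMatrix (Fin n)}
    {W : Type u} [Group W] (cs : CoxeterSystem M W) :
    ∃ (F W' : Type u) (_ : Group F) (_ : Group W'), Finite F ∧ IsFinRankCoxeterGroup F ∧
      IsRigidFactor.{u, v} W' ∧ Nonempty (W ≃* F × W') := by
  induction n using Nat.strong_induction_on generalizing W with
  | _ n ih =>
    by_cases hfin : Finite W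
    · exact ⟨W, PUnit, inferInstance, inferInstance, hfin, ⟨n, M, ⟨cs⟩⟩, .of_subsingleton _,
        ⟨MulEquiv.prodUnique.symm⟩⟩
    have hinf : Infinite W := not_finite_iff_infinite.1 hfin
    by_cases hM : (coxeterDiagram M).Connected
    · exact ⟨PUnit, W, inferInstance, inferInstance, inferInstance, .of_subsingleton _,
        .of_connected cs hM (h W hinf ⟨n, M, ⟨cs⟩, hM⟩), ⟨MulEquiv.uniqueProd.symm⟩⟩
    have hn : 0 < n := by
      rcases Nat.eq_zero_or_pos n with rfl | hn
      -- Without generators there are no roots, so `W` would be finite.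
      · refine absurd (cs.finite_of_finite_rootSet (Set.finite_empty.subset ?_)) hfin
        rintro _ ⟨-, i, -⟩
        exact i.elim0
      · exact hn
    obtain ⟨k, l, M₁, M₂, hk, hl, ⟨e⟩⟩ := M.exists_prod_of_not_connected hn hM
    obtain ⟨F₁, W₁, _, _, hF₁, hF₁', hW₁, ⟨e₁⟩⟩ :=
      ih k hk (M₁.toCoxeterSystem.map (MulEquiv.ulift : ULift.{u} M₁.Group ≃* _).symm)
    obtain ⟨F₂, W₂, _, _, hF₂, hF₂', hW₂, ⟨e₂⟩⟩ :=
      ih l hl (M₂.toCoxeterSystem.map (MulEquiv.ulift : ULift.{u} M₂.Group ≃* _).symm)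
    exact ⟨F₁ × F₂, W₁ × W₂, inferInstance, inferInstance, inferInstance, hF₁'.prod hF₂',
      hW₁.prod hW₂, ⟨cs.mulEquiv.trans (e.trans (((MulEquiv.ulift.symm.trans e₁).prodCongr
        (MulEquiv.ulift.symm.trans e₂)).trans (MulEquiv.prodProdProdComm _ _ _ _)))⟩⟩

theorem TorsionGeneratedModelsAreCoxeter.of_connected
    (h : ∀ (W : Type u) [Group W], Infinite W → IsConnectedCoxeterGroup W →
      TorsionGeneratedModelsAreCoxeter.{u, v} W) (W : Type u) [Group W]
    (hW : IsFinRankCoxeterGroup W) : TorsionGeneratedModelsAreCoxeter.{u, v} W := by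
  obtain ⟨n, M, ⟨cs⟩⟩ := hW
  obtain ⟨F, W', _, _, _, hF, hW', ⟨e⟩⟩ := cs.exists_finite_prod_rigidFactor h
  exact (TorsionGeneratedModelsAreCoxeter.finite_prod hF hW').of_mulEquiv e.symm

/-- The conjecture holds for all Coxeter groups if and only if it holds for the irreducible ones,
for either description of irreducibility: by connectedness of a Coxeter diagram, or by the absence
of non-trivial direct product decompositions. -/
theorem theorem1p3 :
    ((∀ (W : Type u) [Group W], IsFinRankCoxeterGroup W →
          TorsionGeneratedModelsAreCoxeter.{u, v} W) ↔
      (∀ (W : Type u) [Group W], IsConnectedCoxeterGroup W →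
          TorsionGeneratedModelsAreCoxeter.{u, v} W)) ∧
    ((∀ (W : Type u) [Group W], IsFinRankCoxeterGroup W →
          TorsionGeneratedModelsAreCoxeter.{u, v} W) ↔
      (∀ (W : Type u) [Group W], IsFinRankCoxeterGroup W → DirectlyIndecomposable W →
          TorsionGeneratedModelsAreCoxeter.{u, v} W)) := by
  refine ⟨⟨fun h W _ ⟨n, M, cs, _⟩ => h W ⟨n, M, cs⟩, fun h => ?_⟩,
    ⟨fun h W _ hW _ => h W hW, fun h => ?_⟩⟩
  · exact TorsionGeneratedModelsAreCoxeter.of_connected fun W _ _ hW => h W hW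
  -- Infinitude matters here: the dihedral group of order 12 has a connected diagram but is a
  -- nontrivial direct product.
  · refine TorsionGeneratedModelsAreCoxeter.of_connected fun W _ _ ⟨n, M, ⟨cs⟩, hM⟩ => ?_
    exact h W ⟨n, M, ⟨cs⟩⟩ (cs.directlyIndecomposable hM)
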